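/- Consider the problem of minimizing $f(x)$ subject to $Ax=b$, $x\in X=\{x\in\mathbb R^n: Hx\le h\}$, where $A\in\mathbb R^{m\times n}$ is nonzero, the feasible set is nonempty, $f:\mathbb R^n\to\mathbb R$ is differentiable with $L_f$-Lipschitz gradient ($L_f\ge 0$), and $f$ is bounded below on the feasible set. A stochastic oracle $F(x,\xi)$, jointly measurable, satisfies $\mathbb E_\xi F(x,\xi)=\nabla f(x)$ and $\mathbb E_\xi\|F(x,\xi)-\nabla f(x)\|^2\le\sigma^2$ for every $x$. For $\rho\ge 0$ put $\mu=\max\{2,4L_f\}$, $\lambda=L_K=L_f+\rho\|A\|^2+\mu$, and $$K(x,y,z)=f(x)+\langle Ax-b,y\rangle+\tfrac{\rho}{2}\|Ax-b\|^2+\tfrac{\mu}{2}\|x-z\|^2,$$ $$G(x,y,z,\xi)=F(x,\xi)+A^\top y+\rho A^\top(Ax-b)+\mu(x-z).$$ Let $x^*(y,z)$ be the minimizer of $K(\cdot,y,z)$ over $X$ and $\bar x^*(z)$ the minimizer of $f+\frac{\mu}{2}\|\cdot-z\|^2$ over $\{x\in X: Ax=b\}$. Call $\bar\sigma>0$ an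 error bound constant if $\|x^*(y,z)-\bar x^*(z)\|\le\bar\sigma\|Ax^*(y,z)-b\|$ for all $y,z$. For a number of iterations $T\ge 1$ let $$\tau=\frac{1}{6\lambda^2\sqrt T},\quad \eta=\min\Big\{\frac{2\mu+\rho\|A\|^2}{4\|A\|^4},\frac{\tau}{200\|A\|^2},\frac{\tau(2\mu+\rho\|A\|^2)}{20\|A\|^2}\Big\},\quad \beta=\min\Big\{\frac{\tau}{100},\frac{1}{50\lambda},\frac{\eta}{36\mu\bar\sigma^2}\Big\}.$$ Algorithm: start from $x_0=z_0\in X$ and $y_0\in\mathbb R^m$; for $t=0,\dots,T-1$, with i.i.d. samples $\xi_t$, $$y_{t+1}=y_t+\eta(Ax_t-b),\quad x_{t+1}=\mathrm{proj}_X\big(x_t-\tau G(x_t,y_{t+1},z_t,\xi_t)\big),\quad z_{t+1}=z_t+\beta(x_t-z_t).$$ Draw $t^*$ uniformly from $\{1,\dots,T\}$, independently of the samples. Post-processing: with $B$ fresh i.i.d. samples $\xi'_1,\dots,\xi'_B$ and a fixed step size $0<\hat\tau\le 1/L_K$, let $$\hat x=\mathrm{proj}_X\Big(x_{t^*}-\hat\tau\,\frac1B\sum_{i=1}^B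 G(x_{t^*},y_{t^*+1},z_{t^*},\xi'_i)\Big),\qquad y_{t^*+1}=y_{t^*}+\eta(Ax_{t^*}-b).$$ Claim. An error bound constant exists that depends only on $A$, $H$, $L_f$, $\rho$. Moreover, for every error bound constant $\bar\sigma>0$ there are constants $c_T,c_B,C>0$, which may depend on the problem $(f,A,b,H,h,L_f)$, $\rho$, $\sigma$, $\bar\sigma$, $x_0$, $y_0$ and $\hat\tau$, but not on $\varepsilon$, nor on the oracle or the probability spaces, such that for all $\varepsilon\in(0,1]$, all $T\ge c_T\varepsilon^{-4}$ and all $B\ge c_B\varepsilon^{-2}$, the point $\hat x$ is an $\varepsilon$-stationary point in expectation: $$\mathbb E\|A\hat x-b\|^2\le\varepsilon^2,\quad\text{and there is a random } v\in\nabla f(\hat x)+A^\top y_{t^*+1}+N_X(\hat x)\text{ with }\mathbb E\|v\|^2\le\varepsilon^2,$$ where $N_X(\hat x)$ is the normal cone of $X$ at $\hat x$. With $T=\lceil c_T\varepsilon^{-4}\rceil$ and $B=\lceil c_B\varepsilon^{-2}\rceil$, the whole procedure draws at most $C\varepsilon^{-4}$ samples of the oracle. -/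

import Mathlib

open MeasureTheory ProbabilityTheory

noncomputable section

/-- Euclidean space of dimension `n`. -/
abbrev Vec (n : ℕ) : Type := EuclideanSpace ℝ (Fin n)

/-- A minimizer of `φ` over `X` (an arbitrary point if there is none). -/
def argminOn {n : ℕ} (φ : Vec n → ℝ) (X : Set (Vec n)) : Vec n :=
  Classical.epsilon fun u => u ∈ X ∧ ∀ v ∈ X, φ u ≤ φ v

/-- Euclidean projection onto `X`. -/
def projOn {n : ℕ} (X : Set (Vec n)) (x : Vec n) : Vec n :=
  argminOn (fun v => ‖x - v‖ ^ 2) X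

/-- The normal cone of `X` at `x`, i.e. the subdifferential at `x` of the indicator function of `X`
(empty if `x ∉ X`). -/
def normalCone {n : ℕ} (X : Set (Vec n)) (x : Vec n) : Set (Vec n) :=
  {g | x ∈ X ∧ ∀ v ∈ X, inner ℝ g (v - x) ≤ 0}

/-- The data of the problem: minimize `f x` subject to `A x = b` and `H x ≤ h`. -/
structure LinConProblem (n m p : ℕ) where
  f : Vec n → ℝ
  A : Vec n →L[ℝ] Vec m
  b : Vec m
  H : Vec n →L[ℝ] Vec p
  h : Vec p

/-- The parameters of the algorithm: penalty `ρ`, proximal weight `μ`, primal step size `τ`,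
dual step size `η`, and averaging weight `β`. -/
structure AlgParams where
  ρ : ℝ
  μ : ℝ
  τ : ℝ
  η : ℝ
  β : ℝ

/-- State of the algorithm at time `t`: the iterates `x_t`, `y_t`, `z_t` and the number of
samples of the stochastic oracle that have been drawn so far. -/
structure AlgState (n m : ℕ) where
  x : Vec n
  y : Vec m
  z : Vec n
  calls : ℕ

/-- Output of the whole procedure: primal point, multiplier, and the total number of
samples of the stochastic oracle that have been drawn. -/
structure AlgOutput (n m : ℕ) where
  x : Vec n
  y : Vec m
  calls : ℕ

namespace LinConProblem

variable {n m p : ℕ} (pb : LinConProblem n m p)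

/-- The polyhedron `X = {x : H x ≤ h}`. -/
def X : Set (Vec n) := {x | ∀ i, pb.H x i ≤ pb.h i}

/-- The feasible set `{x ∈ X : A x = b}`. -/
def feasible : Set (Vec n) := {x | x ∈ pb.X ∧ pb.A x = pb.b}

/-- Assumptions on the problem: it is feasible, `f` is `Lf`-smooth on the whole space, and `f` is
bounded below on the feasible set. -/
structure Regular (Lf : ℝ) : Prop where
  feasible_nonempty : pb.feasible.Nonempty
  differentiable : Differentiable ℝ pb.f
  gradient_lipschitz : ∀ x x', ‖gradient pb.f x - gradient pb.f x'‖ ≤ Lf * ‖x - x'‖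
  bddBelow : ∃ flow : ℝ, ∀ x ∈ pb.feasible, flow ≤ pb.f x

/-- The proximal augmented Lagrangian
`K(x, y, z) = f(x) + ⟨A x - b, y⟩ + (ρ/2)‖A x - b‖² + (μ/2)‖x - z‖²`. -/
def proxAL (ρ μ : ℝ) (x : Vec n) (y : Vec m) (z : Vec n) : ℝ :=
  pb.f x + inner ℝ (pb.A x - pb.b) y + ρ / 2 * ‖pb.A x - pb.b‖ ^ 2 + μ / 2 * ‖x - z‖ ^ 2

/-- `x*(y, z)`, the minimizer of `K(·, y, z)` over `X`. -/
def xStar (ρ μ : ℝ) (y : Vec m) (z : Vec n) : Vec n :=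
  argminOn (fun x => pb.proxAL ρ μ x y z) pb.X

/-- The minimizer of `f + (μ/2)‖· - z‖²` over the feasible set. -/
def xBarStar (μ : ℝ) (z : Vec n) : Vec n :=
  argminOn (fun x => pb.f x + μ / 2 * ‖x - z‖ ^ 2) pb.feasible

/-- `σbar` is a constant for which the global error bound
`‖x*(y, z) - xbar*(z)‖ ≤ σbar ‖A x*(y, z) - b‖` holds for all `y`, `z`. -/
def IsErrorBoundConst (ρ μ σbar : ℝ) : Prop :=
  ∀ (y : Vec m) (z : Vec n),
    ‖pb.xStar ρ μ y z - pb.xBarStar μ z‖ ≤ σbar * ‖pb.A (pb.xStar ρ μ y z) - pb.b‖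

/-- The stochastic gradient of `K(·, y, z)` at `x` built from one sample `s` of the oracle `F`. -/
def stochGrad {S : Type*} (ρ μ : ℝ) (F : Vec n → S → Vec n)
    (x : Vec n) (y : Vec m) (z : Vec n) (s : S) : Vec n :=
  F x s + ContinuousLinearMap.adjoint pb.A y
    + ρ • ContinuousLinearMap.adjoint pb.A (pb.A x - pb.b) + μ • (x - z)

/-- The dual update `y ↦ y + η (A x - b)`. -/
def dualStep (η : ℝ) (x : Vec n) (y : Vec m) : Vec m := y + η • (pb.A x - pb.b)

/-- One iteration; it draws the next unused sample of the stream `ξ`. -/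
def algStep {S : Type*} (par : AlgParams) (F : Vec n → S → Vec n) (ξ : ℕ → S)
    (s : AlgState n m) : AlgState n m where
  x := projOn pb.X (s.x - par.τ •
    pb.stochGrad par.ρ par.μ F s.x (pb.dualStep par.η s.x s.y) s.z (ξ s.calls))
  y := pb.dualStep par.η s.x s.y
  z := s.z + par.β • (s.x - s.z)
  calls := s.calls + 1

/-- The state of the algorithm after `t` iterations, started at `x₀ = z₀` and `y₀`. -/
def algRun {S : Type*} (par : AlgParams) (F : Vec n → S → Vec n) (ξ : ℕ → S)
    (x₀ : Vec n) (y₀ : Vec m) : ℕ → AlgState n m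
  | 0 => ⟨x₀, y₀, x₀, 0⟩
  | t + 1 => pb.algStep par F ξ (algRun par F ξ x₀ y₀ t)

/-- The average of the stochastic gradients built from the `B` samples `ξ k, …, ξ (k + B - 1)`. -/
def miniBatchGrad {S : Type*} (ρ μ : ℝ) (F : Vec n → S → Vec n) (ξ : ℕ → S) (k B : ℕ)
    (x : Vec n) (y : Vec m) (z : Vec n) : Vec n :=
  (1 / (B : ℝ)) • ∑ i ∈ Finset.range B, pb.stochGrad ρ μ F x y z (ξ (k + i))

/-- The whole procedure: run `T` iterations, take the iterates at the index `t`, and perform one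
projected step of size `τhat` with a minibatch of `B` fresh samples. The output is `xhat`, the
multiplier `y_{t+1}`, and the total number of samples. -/
def procedure {S : Type*} (par : AlgParams) (τhat : ℝ) (F : Vec n → S → Vec n) (ξ : ℕ → S)
    (x₀ : Vec n) (y₀ : Vec m) (T B t : ℕ) : AlgOutput n m :=
  let s := pb.algRun par F ξ x₀ y₀ t
  let k := (pb.algRun par F ξ x₀ y₀ T).calls
  let y := pb.dualStep par.η s.x s.y
  { x := projOn pb.X (s.x - τhat • pb.miniBatchGrad par.ρ par.μ F ξ k B s.x y s.z)
    y := y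
    calls := k + B }

/-- The set `∇f(x) + Aᵀ y + N_X(x)`. -/
def stationaritySet (x : Vec n) (y : Vec m) : Set (Vec n) :=
  {v | v - (gradient pb.f x + ContinuousLinearMap.adjoint pb.A y) ∈ normalCone pb.X x}

/-- The random point `xhat` with the random multiplier `yhat` is `ε`-stationary in mean square:
`E‖A xhat - b‖² ≤ ε²`, and there is a random `v ∈ ∇f(xhat) + Aᵀ yhat + N_X(xhat)` with
`E‖v‖² ≤ ε²`. -/
def IsEpsStationary {Ω : Type*} [MeasurableSpace Ω] (P : Measure Ω)
    (xhat : Ω → Vec n) (yhat : Ω → Vec m) (ε : ℝ) : Prop :=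
  (MemLp (fun ω => pb.A (xhat ω) - pb.b) 2 P ∧ ∫ ω, ‖pb.A (xhat ω) - pb.b‖ ^ 2 ∂P ≤ ε ^ 2) ∧
  ∃ v : Ω → Vec n, (∀ ω, v ω ∈ pb.stationaritySet (xhat ω) (yhat ω)) ∧
    MemLp v 2 P ∧ ∫ ω, ‖v ω‖ ^ 2 ∂P ≤ ε ^ 2

end LinConProblem

/-- The proximal weight `μ = max {2, 4 Lf}`. -/
def muParam (Lf : ℝ) : ℝ := max 2 (4 * Lf)

/-- `L_K = Lf + ρ ‖A‖² + μ`, where `a = ‖A‖`. -/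
def LKParam (Lf ρ a : ℝ) : ℝ := Lf + ρ * a ^ 2 + muParam Lf

/-- `τ = 1 / (6 λ² √T)` with `λ = L_K`. -/
def tauParam (Lf ρ a : ℝ) (T : ℕ) : ℝ := 1 / (6 * LKParam Lf ρ a ^ 2 * Real.sqrt T)

/-- `η = min {(2μ + ρ‖A‖²) / (4‖A‖⁴), τ / (200‖A‖²), τ (2μ + ρ‖A‖²) / (20‖A‖²)}`. -/
def etaParam (Lf ρ a : ℝ) (T : ℕ) : ℝ :=
  min ((2 * muParam Lf + ρ * a ^ 2) / (4 * a ^ 4))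
    (min (tauParam Lf ρ a T / (200 * a ^ 2))
      (tauParam Lf ρ a T * (2 * muParam Lf + ρ * a ^ 2) / (20 * a ^ 2)))

/-- `β = min {τ / 100, 1 / (50 λ), η / (36 μ σbar²)}` with `λ = L_K`. -/
def betaParam (Lf ρ a σbar : ℝ) (T : ℕ) : ℝ :=
  min (tauParam Lf ρ a T / 100)
    (min (1 / (50 * LKParam Lf ρ a)) (etaParam Lf ρ a T / (36 * muParam Lf * σbar ^ 2)))

/-- The parameters of a run with `T` iterations. -/
def algParams (Lf ρ a σbar : ℝ) (T : ℕ) : AlgParams where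
  ρ := ρ
  μ := muParam Lf
  τ := tauParam Lf ρ a T
  η := etaParam Lf ρ a T
  β := betaParam Lf ρ a σbar T

/-- `F(x, ·)`, with the sample drawn from `Q`, is an unbiased estimator of `∇f(x)` with variance at
most `σ²`, for every `x`. -/
structure IsStochasticOracle {n : ℕ} {S : Type*} [MeasurableSpace S] (f : Vec n → ℝ) (σ : ℝ)
    (Q : Measure S) (F : Vec n → S → Vec n) : Prop where
  measurable : Measurable (Function.uncurry F)
  integrable : ∀ x, Integrable (F x) Q
  unbiased : ∀ x, ∫ s, F x s ∂Q = gradient f x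
  integrable_sq : ∀ x, Integrable (fun s => ‖F x s - gradient f x‖ ^ 2) Q
  variance_le : ∀ x, ∫ s, ‖F x s - gradient f x‖ ^ 2 ∂Q ≤ σ ^ 2

/-- `ξ` is an i.i.d. sequence with law `Q`, and `tstar` is uniformly distributed on `{1, …, T}` and
independent of `ξ`. -/
structure IsSampling {S Ω : Type*} [MeasurableSpace S] [MeasurableSpace Ω] (P : Measure Ω)
    (Q : Measure S) (ξ : ℕ → Ω → S) (T : ℕ) (tstar : Ω → ℕ) : Prop where
  measurable_sample : ∀ k, Measurable (ξ k)
  law : ∀ k, P.map (ξ k) = Q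
  indep : iIndepFun ξ P
  measurable_tstar : Measurable tstar
  uniform : ∀ t ∈ Finset.Icc 1 T, P (tstar ⁻¹' {t}) = (T : ENNReal)⁻¹
  indep_tstar : IndepFun tstar (fun ω k => ξ k ω) P

end

/-!
The proof combines a global error bound for linearly constrained proximal problems with a
potential that decreases in expectation along the iterations.

**Error bound.** Put `r = A x*(y, z) - b`. In the optimality condition of `x*(y, z)` the
multiplier terms vanish along directions in the kernel of `A`, so `x*(y, z)` solves the
variational inequality of the operator `∇f + μ(· - z)` over the polyhedron `{x ∈ X : A x = b +
r}`, and `x̄*(z)` solves the same one over `{x ∈ X : A x = b}`. The bound is thus Lipschitz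
stability, with respect to the right-hand side, of a strongly monotone variational inequality over
a polyhedron with fixed constraint normals (`exists_lipschitz_polyhedral_VI`). Subtracting two
optimality systems gives `γ‖x - x'‖² ≤ N ‖l - l'‖ ‖b - b'‖` for any multipliers `l`, `l'`
(`IsKKT.norm_sub_sq_le`). By Carathéodory's reduction the multipliers can be taken from finitely
many linear functions of the operator value (`exists_finite_conic_coordinates`). Two points that
share such a function satisfy `‖l - l'‖ ≤ M L ‖x - x'‖`, and the estimate becomes linear. Along a
segment of right-hand sides the solution is continuous, nearby points share a function, and the
local Lipschitz estimates add up. The existence of multipliers is Farkas' lemma (`farkas`).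

**Descent.** With `d(y, z) = min_X K(·, y, z)` and `P(z)` the minimum of `f + (μ/2)‖· - z‖²` over
the feasible set, weak duality `d ≤ P` bounds the potential `Φ = ‖x - x*(y, z)‖² - d(y, z) + 2
P(z)` from below by the infimum of `f` there. The choice `μ ≥ 4 Lf` makes `K(·, y, z)` strongly
convex, so a projected stochastic gradient step contracts `‖x - x*‖²` up to a term of order
`τ²σ²`, while the dual and averaging steps decrease `-d + 2P` by multiples of `η‖A x* - b‖²` and
`μβ‖x - z‖²` up to cross terms (`LinConProblem.dual_primal_descent`). The one cross term without a
factor that contracts, `⟨x* - x̄*, x - z⟩`, is handled by the error bound and the condition `36 μ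
σbar² β ≤ η`; the step sizes absorb the remaining ones (`StepSizes.descent_le`). The result is
`LinConProblem.lintegral_potential_step`. It is summed over the run with Lebesgue integrals of
nonnegative functions, so no integrability of the iterates has to be established beforehand.

**Rate.** All three step sizes are at least a constant times `1/√T`, and `T τ²` is constant; hence
the residual `‖x - x*‖² + ‖A x* - b‖² + ‖x - z‖²` at the random index has mean `O(1/√T)`. The
optimality condition of the last projection gives an element of `∇f(x̂) + Aᵀ y + N_X(x̂)` whose
square, like that of the infeasibility of `x̂`, is at most a constant times the residual plus the
squared error of the minibatch gradient, which has mean at most `σ²/B`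
(`LinConProblem.exists_outPoint_bound`, `LinConProblem.exists_output_rate`).
-/

noncomputable section

/-! ### Strongly monotone gradients and variational inequalities -/

section ConvexAnalysis

variable {V : Type*} [NormedAddCommGroup V] [InnerProductSpace ℝ V]

/-- `u` solves the variational inequality `⟨g u, v - u⟩ ≥ 0` for all `v ∈ X`; for `g = ∇φ` this is
the first-order optimality condition for minimizing `φ` over `X`. -/
def IsVISol (g : V → V) (X : Set V) (u : V) : Prop :=
  u ∈ X ∧ ∀ v ∈ X, 0 ≤ inner ℝ (g u) (v - u)

/-- `g` is strongly monotone with modulus `γ`. -/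
def StronglyMonotone (g : V → V) (γ : ℝ) : Prop :=
  ∀ x y, γ * ‖x - y‖ ^ 2 ≤ inner ℝ (g x - g y) (x - y)

/-- The solution of a strongly monotone variational inequality depends on the operator in a
Lipschitz way. -/
theorem IsVISol.norm_sub_le {g₁ g₂ : V → V} {X : Set V} {u₁ u₂ : V} {γ : ℝ}
    (hg : StronglyMonotone g₁ γ) (h₁ : IsVISol g₁ X u₁) (h₂ : IsVISol g₂ X u₂) :
    γ * ‖u₁ - u₂‖ ≤ ‖g₁ u₂ - g₂ u₂‖ := by
  have a := h₁.2 u₂ h₂.1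
  have b := h₂.2 u₁ h₁.1
  have c := hg u₁ u₂
  have d := real_inner_le_norm (g₂ u₂ - g₁ u₂) (u₁ - u₂)
  have e : γ * ‖u₁ - u₂‖ ^ 2 ≤ ‖g₁ u₂ - g₂ u₂‖ * ‖u₁ - u₂‖ := by
    rw [norm_sub_rev (g₁ u₂)]
    have : inner ℝ (g₁ u₁) (u₂ - u₁) = - inner ℝ (g₁ u₁) (u₁ - u₂) := by
      rw [← inner_neg_right, neg_sub]
    simp only [inner_sub_left] at c d
    linarith
  rcases (norm_nonneg (u₁ - u₂)).eq_or_lt with h0 | h0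
  · rw [← h0]; simp
  · exact le_of_mul_le_mul_right (by nlinarith) h0

theorem IsVISol.unique {g : V → V} {X : Set V} {u₁ u₂ : V} {γ : ℝ} (hγ : 0 < γ)
    (hg : StronglyMonotone g γ) (h₁ : IsVISol g X u₁) (h₂ : IsVISol g X u₂) : u₁ = u₂ := by
  have h := h₁.norm_sub_le hg h₂
  rw [sub_self, norm_zero] at h
  have : ‖u₁ - u₂‖ ≤ 0 := by
    by_contra hc
    push Not at hc
    nlinarith
  exact sub_eq_zero.1 (norm_le_zero_iff.1 this)

variable [CompleteSpace V]

theorem hasDerivAt_comp_line {φ : V → ℝ} {g : V → V} (hφ : ∀ x, HasGradientAt φ (g x) x)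
    (x d : V) (t : ℝ) : HasDerivAt (fun s : ℝ => φ (x + s • d)) (inner ℝ (g (x + t • d)) d) t := by
  have h1 : HasDerivAt (fun s : ℝ => x + s • d) d t := by
    simpa using ((hasDerivAt_id t).smul_const d).const_add x
  have h2 := (hφ (x + t • d)).hasFDerivAt.comp_hasDerivAt t h1
  rwa [InnerProductSpace.toDual_apply_apply] at h2

/-- A function with strongly monotone gradient lies above its tangent paraboloids. -/
theorem StronglyMonotone.lower_bound {φ : V → ℝ} {g : V → V} {γ : ℝ}
    (hφ : ∀ x, HasGradientAt φ (g x) x) (hg : StronglyMonotone g γ) (x u : V) :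
    φ x + inner ℝ (g x) (u - x) + γ / 2 * ‖u - x‖ ^ 2 ≤ φ u := by
  set d := u - x with hd
  have hder : ∀ t : ℝ, HasDerivAt
      (fun s : ℝ => φ (x + s • d) - s * inner ℝ (g x) d - γ / 2 * ‖d‖ ^ 2 * s ^ 2)
      (inner ℝ (g (x + t • d)) d - inner ℝ (g x) d - γ * ‖d‖ ^ 2 * t) t := by
    intro t
    have h1 := hasDerivAt_comp_line hφ x d t
    have h2 := (hasDerivAt_id t).mul_const (inner ℝ (g x) d)
    have h3 := ((hasDerivAt_id t).pow 2).const_mul (γ / 2 * ‖d‖ ^ 2)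
    refine ((h1.sub h2).sub h3).congr_deriv ?_
    simp only [id, one_mul, Nat.cast_ofNat, Nat.reduceSub, pow_one]
    ring
  have hmono : MonotoneOn
      (fun s : ℝ => φ (x + s • d) - s * inner ℝ (g x) d - γ / 2 * ‖d‖ ^ 2 * s ^ 2)
      (Set.Icc 0 1) := by
    refine monotoneOn_of_deriv_nonneg (convex_Icc 0 1)
      (fun t _ => (hder t).continuousAt.continuousWithinAt)
      (fun t _ => (hder t).differentiableAt.differentiableWithinAt) ?_
    intro t ht
    rw [interior_Icc] at ht
    rw [(hder t).deriv]
    have h := hg (x + t • d) x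
    rw [add_sub_cancel_left, norm_smul, Real.norm_eq_abs, mul_pow, sq_abs, inner_smul_right,
      inner_sub_left] at h
    have : t * (γ * ‖d‖ ^ 2 * t) ≤ t * (inner ℝ (g (x + t • d)) d - inner ℝ (g x) d) := by
      linarith
    have := le_of_mul_le_mul_left this ht.1
    linarith
  have h := hmono (Set.left_mem_Icc.2 zero_le_one) (Set.right_mem_Icc.2 zero_le_one) zero_le_one
  simp only [zero_smul, add_zero, one_smul] at h
  have hxu : x + d = u := by simp [hd]
  rw [hxu] at h
  linarith

theorem isVISol_of_isMin {φ : V → ℝ} {g : V → V} (hφ : ∀ x, HasGradientAt φ (g x) x)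
    {X : Set V} (hX : Convex ℝ X) {u : V} (hu : u ∈ X) (hmin : ∀ v ∈ X, φ u ≤ φ v) :
    IsVISol g X u := by
  refine ⟨hu, fun v hv => ?_⟩
  have h1 := hasDerivAt_comp_line hφ u (v - u) 0
  rw [zero_smul, add_zero] at h1
  have hmin' : IsLocalMinOn (fun s : ℝ => φ (u + s • (v - u))) (Set.Icc 0 1) 0 := by
    refine Filter.eventually_of_mem self_mem_nhdsWithin fun s hs => ?_
    simp only [zero_smul, add_zero]
    exact hmin _ (hX.add_smul_sub_mem hu hv hs)
  have h2 := hmin'.hasFDerivWithinAt_nonneg h1.hasFDerivAt.hasFDerivWithinAt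
    (y := (1 : ℝ)) (mem_posTangentConeAt_of_segment_subset (by simp [segment_eq_Icc]))
  simpa using h2

theorem StronglyMonotone.exists_isMin [FiniteDimensional ℝ V] {φ : V → ℝ} {g : V → V} {γ : ℝ}
    (hγ : 0 < γ) (hφ : ∀ x, HasGradientAt φ (g x) x) (hg : StronglyMonotone g γ)
    {X : Set V} (hc : IsClosed X) (hne : X.Nonempty) : ∃ u, u ∈ X ∧ ∀ v ∈ X, φ u ≤ φ v := by
  obtain ⟨x₀, hx₀⟩ := hne
  have hcont : Continuous φ := continuous_iff_continuousAt.2 fun x =>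
    (hφ x).hasFDerivAt.continuousAt
  obtain ⟨u, hu, hmin⟩ := hcont.continuousOn.exists_isMinOn' hc hx₀ (by
    refine Filter.Eventually.filter_mono inf_le_left ?_
    -- outside the ball of radius `2‖g x₀‖/γ` around `x₀` the quadratic term dominates
    have hmem : (Metric.closedBall x₀ (2 * ‖g x₀‖ / γ))ᶜ ∈ Filter.cocompact V :=
      (isCompact_closedBall _ _).compl_mem_cocompact
    filter_upwards [hmem] with v hv
    rw [Set.mem_compl_iff, Metric.mem_closedBall, not_le, dist_eq_norm, div_lt_iff₀ hγ] at hv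
    have h1 := hg.lower_bound hφ x₀ v
    have h2 := abs_le.1 (abs_real_inner_le_norm (g x₀) (v - x₀))
    nlinarith [norm_nonneg (v - x₀), h2.1])
  exact ⟨u, hu, fun v hv => hmin hv⟩

end ConvexAnalysis

section Projection

variable {n : ℕ}

theorem argminOn_spec {φ : Vec n → ℝ} {X : Set (Vec n)}
    (h : ∃ u, u ∈ X ∧ ∀ v ∈ X, φ u ≤ φ v) :
    argminOn φ X ∈ X ∧ ∀ v ∈ X, φ (argminOn φ X) ≤ φ v :=
  Classical.epsilon_spec h

theorem hasGradientAt_half_norm_sub_sq {V : Type*} [NormedAddCommGroup V] [InnerProductSpace ℝ V]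
    [CompleteSpace V] (c : ℝ) (z x : V) :
    HasGradientAt (fun v => c / 2 * ‖v - z‖ ^ 2) (c • (x - z)) x := by
  rw [hasGradientAt_iff_hasFDerivAt]
  have h := (((hasFDerivAt_id x).sub_const z).norm_sq).const_mul (c / 2)
  refine h.congr_fderiv ?_
  ext v
  simp
  ring

variable {X : Set (Vec n)}

theorem projOn_isVISol (hc : IsClosed X) (hconv : Convex ℝ X) (hne : X.Nonempty) (x : Vec n) :
    IsVISol (fun v => v - x) X (projOn X x) := by
  have hgrad : ∀ v, HasGradientAt (fun v : Vec n => (1 : ℝ) / 2 * ‖v - x‖ ^ 2) (v - x) v := by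
    intro v
    simpa using hasGradientAt_half_norm_sub_sq 1 x v
  have hmono : StronglyMonotone (fun v : Vec n => v - x) 1 := by
    intro u v
    rw [sub_sub_sub_cancel_right, real_inner_self_eq_norm_sq, one_mul]
  obtain ⟨u, hu, hmin⟩ := hmono.exists_isMin one_pos hgrad hc hne
  have hspec := argminOn_spec (φ := fun v => ‖x - v‖ ^ 2) (X := X) ⟨u, hu, fun v hv => by
    have := hmin v hv
    rw [norm_sub_rev x u, norm_sub_rev x v]
    linarith⟩
  refine isVISol_of_isMin hgrad hconv hspec.1 fun v hv => ?_
  have h : ‖x - projOn X x‖ ^ 2 ≤ ‖x - v‖ ^ 2 := hspec.2 v hv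
  rw [norm_sub_rev x, norm_sub_rev x] at h
  change 1 / 2 * ‖projOn X x - x‖ ^ 2 ≤ 1 / 2 * ‖v - x‖ ^ 2
  linarith

theorem projOn_mem (hc : IsClosed X) (hconv : Convex ℝ X) (hne : X.Nonempty) (x : Vec n) :
    projOn X x ∈ X :=
  (projOn_isVISol hc hconv hne x).1

theorem sub_projOn_mem_normalCone (hc : IsClosed X) (hconv : Convex ℝ X) (hne : X.Nonempty)
    (x : Vec n) : x - projOn X x ∈ normalCone X (projOn X x) := by
  refine ⟨projOn_mem hc hconv hne x, fun v hv => ?_⟩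
  have := (projOn_isVISol hc hconv hne x).2 v hv
  rw [← neg_sub, inner_neg_left]
  linarith

theorem norm_projOn_sub_le (hc : IsClosed X) (hconv : Convex ℝ X) (hne : X.Nonempty)
    (x y : Vec n) : ‖projOn X x - projOn X y‖ ≤ ‖x - y‖ := by
  have h := (projOn_isVISol hc hconv hne x).norm_sub_le (γ := 1) (fun u v => by
    rw [sub_sub_sub_cancel_right, real_inner_self_eq_norm_sq, one_mul])
    (projOn_isVISol hc hconv hne y)
  rwa [one_mul, sub_sub_sub_cancel_left, norm_sub_rev y x] at h

theorem continuous_projOn (hc : IsClosed X) (hconv : Convex ℝ X) (hne : X.Nonempty) :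
    Continuous (projOn X) :=
  (LipschitzWith.of_dist_le_mul (K := 1) fun x y => by
    simpa [dist_eq_norm] using norm_projOn_sub_le hc hconv hne x y).continuous

/-- The solutions of a variational inequality are the fixed points of the projected step. -/
theorem IsVISol.projOn_eq (hc : IsClosed X) (hconv : Convex ℝ X) {g : Vec n → Vec n} {u : Vec n}
    (h : IsVISol g X u) {τ : ℝ} (hτ : 0 ≤ τ) : projOn X (u - τ • g u) = u := by
  refine (projOn_isVISol hc hconv ⟨u, h.1⟩ _).unique (γ := 1) one_pos (fun u v => by
    rw [sub_sub_sub_cancel_right, real_inner_self_eq_norm_sq, one_mul]) ⟨h.1, fun v hv => ?_⟩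
  rw [show (fun v => v - (u - τ • g u)) u = τ • g u from sub_sub_cancel _ _,
    real_inner_smul_left]
  exact mul_nonneg hτ (h.2 v hv)

end Projection

/-! ### Finitely generated cones and Farkas' lemma -/

section Cone

variable {ι V : Type*} [Fintype ι]

/-- Carathéodory's reduction for conic combinations: the support can be shrunk until the generators
in it are linearly independent. -/
theorem exists_conic_minimal_support [AddCommGroup V] [Module ℝ V] (a : ι → V) (c : ι → ℝ)
    (hc : ∀ k, 0 ≤ c k) :
    ∃ c' : ι → ℝ, (∀ k, 0 ≤ c' k) ∧ ∑ k, c' k • a k = ∑ k, c k • a k ∧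
      (∀ k, c k = 0 → c' k = 0) ∧
      ∀ d : ι → ℝ, (∀ k, c' k = 0 → d k = 0) → ∑ k, d k • a k = 0 → d = 0 := by
  classical
  induction hN : (Finset.univ.filter fun k => c k ≠ 0).card using Nat.strong_induction_on
    generalizing c with
  | _ N ih =>
    by_cases hinj : ∀ d : ι → ℝ, (∀ k, c k = 0 → d k = 0) → ∑ k, d k • a k = 0 → d = 0
    · exact ⟨c, hc, rfl, fun _ h => h, hinj⟩
    push Not at hinj
    obtain ⟨d₀, hd₀, hsum₀, hne₀⟩ := hinj
    -- after a change of sign the relation `d` has a positive coefficient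
    obtain ⟨d, hd, hsum, j, hj⟩ : ∃ d : ι → ℝ, (∀ k, c k = 0 → d k = 0) ∧
        ∑ k, d k • a k = 0 ∧ ∃ j, 0 < d j := by
      obtain ⟨j, hj⟩ := Function.ne_iff.1 hne₀
      rcases lt_or_gt_of_ne hj with h | h
      · refine ⟨-d₀, fun k hk => by simp [hd₀ k hk], by simp [hsum₀], j, ?_⟩
        simpa using h
      · exact ⟨d₀, hd₀, hsum₀, j, h⟩
    obtain ⟨i, hi, hmin⟩ := (Finset.univ.filter fun k => 0 < d k).exists_min_image
      (fun k => c k / d k) ⟨j, by simp [hj]⟩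
    simp only [Finset.mem_filter, Finset.mem_univ, true_and] at hi hmin
    set t := c i / d i with ht
    have ht0 : 0 ≤ t := div_nonneg (hc i) hi.le
    have hci : c i ≠ 0 := fun h => hi.ne' (hd i h)
    obtain ⟨c', h1, h2, h3, h4⟩ := ih
      (Finset.univ.filter fun k => c k - t * d k ≠ 0).card (by
        rw [← hN]
        refine Finset.card_lt_card (Finset.ssubset_iff_of_subset ?_ |>.2 ⟨i, ?_, ?_⟩)
        · intro k hk
          simp only [Finset.mem_filter, Finset.mem_univ, true_and] at hk ⊢
          intro h
          exact hk (by rw [h, hd k h]; ring)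
        · simpa using hci
        · simp only [Finset.mem_filter, Finset.mem_univ, true_and, not_not]
          rw [ht, div_mul_cancel₀ _ hi.ne', sub_self])
      (fun k => c k - t * d k) (fun k => by
        rcases le_or_gt (d k) 0 with h | h
        · have := mul_nonneg ht0 (neg_nonneg.2 h)
          have := hc k
          nlinarith
        · have := hmin k h
          rw [le_div_iff₀ h] at this
          linarith) rfl
    refine ⟨c', h1, ?_, fun k hk => h3 k (by rw [hk, hd k hk]; ring), h4⟩
    rw [h2]
    simp only [sub_smul, mul_smul, Finset.sum_sub_distrib, ← Finset.smul_sum, hsum, smul_zero,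
      sub_zero]

variable [NormedAddCommGroup V] [InnerProductSpace ℝ V] [FiniteDimensional ℝ V]

/-- The coefficients of a conic combination of the `a k` can be chosen piecewise linearly: finitely
many linear maps (one for each linearly independent subfamily) provide nonnegative coefficients
for every vector of the cone, with support inside that of a given representation. -/
theorem exists_finite_conic_coordinates (a : ι → V) :
    ∃ 𝒯 : Set (V →L[ℝ] (ι → ℝ)), 𝒯.Finite ∧ ∀ c : ι → ℝ, (∀ k, 0 ≤ c k) →
      ∃ T ∈ 𝒯, (∀ k, 0 ≤ T (∑ k, c k • a k) k) ∧
        ∑ k, T (∑ k, c k • a k) k • a k = ∑ k, c k • a k ∧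
        ∀ k, c k = 0 → T (∑ k, c k • a k) k = 0 := by
  classical
  have hex : ∀ J : Finset ι, ∃ T : V →L[ℝ] (ι → ℝ),
      (∀ d : ι → ℝ, (∀ k, k ∉ J → d k = 0) → ∑ k, d k • a k = 0 → d = 0) →
      ∀ c : ι → ℝ, (∀ k, k ∉ J → c k = 0) → T (∑ k, c k • a k) = c := by
    intro J
    by_cases hJ : ∀ d : ι → ℝ, (∀ k, k ∉ J → d k = 0) → ∑ k, d k • a k = 0 → d = 0
    · let S : Submodule ℝ (ι → ℝ) :=
        { carrier := {c | ∀ k, k ∉ J → c k = 0}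
          add_mem' := fun {x y} hx hy k hk => by simp [hx k hk, hy k hk]
          zero_mem' := fun k _ => rfl
          smul_mem' := fun r x hx k hk => by simp [hx k hk] }
      let l : S →ₗ[ℝ] V := (Fintype.linearCombination ℝ a).domRestrict S
      have hl : ∀ c : S, l c = ∑ k, (c : ι → ℝ) k • a k := fun c => by
        simp [l, Fintype.linearCombination_apply]
      have hker : LinearMap.ker l = ⊥ := by
        rw [LinearMap.ker_eq_bot']
        intro c hc0
        rw [hl] at hc0
        exact Subtype.ext (hJ c c.2 hc0)
      obtain ⟨R, hR⟩ := l.exists_leftInverse_of_injective hker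
      refine ⟨LinearMap.toContinuousLinearMap (S.subtype.comp R), fun _ c hc => ?_⟩
      have h1 := LinearMap.congr_fun hR ⟨c, hc⟩
      rw [LinearMap.comp_apply, hl, LinearMap.id_apply] at h1
      change ((R (∑ k, c k • a k) : S) : ι → ℝ) = c
      rw [h1]
    · exact ⟨0, fun h => absurd h hJ⟩
  choose T hT using hex
  refine ⟨Set.range T, Set.finite_range T, fun c hc => ?_⟩
  obtain ⟨c', h1, h2, h3, h4⟩ := exists_conic_minimal_support a c hc
  have h5 : T (Finset.univ.filter fun k => c' k ≠ 0) (∑ k, c k • a k) = c' := by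
    rw [← h2]
    refine hT _ (fun d hd hs => h4 d (fun k hk => hd k (by simp [hk])) hs) c' fun k hk => ?_
    simpa using hk
  refine ⟨T (Finset.univ.filter fun k => c' k ≠ 0), ⟨_, rfl⟩, ?_⟩
  rw [h5]
  exact ⟨h1, h2, h3⟩

theorem isClosed_conicHull (a : ι → V) :
    IsClosed {v : V | ∃ c : ι → ℝ, (∀ k, 0 ≤ c k) ∧ ∑ k, c k • a k = v} := by
  obtain ⟨𝒯, hfin, h𝒯⟩ := exists_finite_conic_coordinates a
  have : {v : V | ∃ c : ι → ℝ, (∀ k, 0 ≤ c k) ∧ ∑ k, c k • a k = v} =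
      ⋃ T ∈ 𝒯, {v : V | (∀ k, 0 ≤ T v k) ∧ ∑ k, T v k • a k = v} := by
    ext v
    simp only [Set.mem_ofPred_eq, Set.mem_iUnion, exists_prop]
    constructor
    · rintro ⟨c, hc, rfl⟩
      obtain ⟨T, hT, h1, h2, -⟩ := h𝒯 c hc
      exact ⟨T, hT, h1, h2⟩
    · rintro ⟨T, -, h1, h2⟩
      exact ⟨_, h1, h2⟩
  rw [this]
  refine hfin.isClosed_biUnion fun T _ => ?_
  refine IsClosed.inter (s₁ := {v : V | ∀ k, 0 ≤ T v k}) ?_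
    (isClosed_eq (by fun_prop) continuous_id)
  simp only [Set.ofPred_forall]
  exact isClosed_iInter fun k => isClosed_le continuous_const (by fun_prop)

/-- **Farkas' lemma** for finitely generated cones. -/
theorem farkas (a : ι → V) (v : V)
    (h : ∀ d, (∀ k, inner ℝ (a k) d ≤ 0) → inner ℝ v d ≤ 0) :
    ∃ c : ι → ℝ, (∀ k, 0 ≤ c k) ∧ ∑ k, c k • a k = v := by
  classical
  set K := {v : V | ∃ c : ι → ℝ, (∀ k, 0 ≤ c k) ∧ ∑ k, c k • a k = v} with hK
  have hconv : Convex ℝ K := by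
    rintro _ ⟨c, hc, rfl⟩ _ ⟨d, hd, rfl⟩ s t hs ht -
    refine ⟨fun k => s * c k + t * d k,
      fun k => add_nonneg (mul_nonneg hs (hc k)) (mul_nonneg ht (hd k)), ?_⟩
    simp only [add_smul, mul_smul, Finset.sum_add_distrib, Finset.smul_sum]
  have hgrad : ∀ u, HasGradientAt (fun u : V => (1 : ℝ) / 2 * ‖u - v‖ ^ 2) (u - v) u := by
    intro u
    simpa using hasGradientAt_half_norm_sub_sq 1 v u
  have hmono : StronglyMonotone (fun u : V => u - v) 1 := by
    intro u v
    rw [sub_sub_sub_cancel_right, real_inner_self_eq_norm_sq, one_mul]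
  have h0 : (0 : V) ∈ K := ⟨0, by simp, by simp⟩
  obtain ⟨u, hu, hmin⟩ := hmono.exists_isMin one_pos hgrad (isClosed_conicHull a) ⟨0, h0⟩
  have hvi := isVISol_of_isMin hgrad hconv hu hmin
  have h1 : inner ℝ v (v - u) ≤ 0 := by
    refine h _ fun k => ?_
    have hmem : u + a k ∈ K := by
      obtain ⟨c, hc, rfl⟩ := hu
      refine ⟨fun i => c i + if i = k then 1 else 0,
        fun i => add_nonneg (hc i) (by split_ifs <;> norm_num), ?_⟩
      simp [add_smul, Finset.sum_add_distrib]
    have : 0 ≤ inner ℝ (u - v) (u + a k - u) := hvi.2 _ hmem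
    rw [add_sub_cancel_left, ← neg_sub, inner_neg_left, real_inner_comm] at this
    linarith
  have h2 : 0 ≤ inner ℝ (u - v) (0 - u) := hvi.2 0 h0
  rw [zero_sub, inner_neg_right, ← neg_sub, inner_neg_left, neg_neg] at h2
  have h3 : ‖v - u‖ ^ 2 ≤ 0 := by
    rw [← real_inner_self_eq_norm_sq, inner_sub_left, real_inner_comm (v - u) u]
    linarith
  have h4 : v - u = 0 :=
    norm_eq_zero.1 (pow_eq_zero_iff two_ne_zero |>.1 (le_antisymm h3 (by positivity)))
  rw [sub_eq_zero.1 h4]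
  exact hu

end Cone

/-! ### Variational inequalities over polyhedra -/

section Polyhedron

variable {ι V : Type*} [Fintype ι] [NormedAddCommGroup V] [InnerProductSpace ℝ V]

/-- The polyhedron `{x : ⟨a k, x⟩ ≤ b k for all k}`. -/
def polyhedron (a : ι → V) (b : ι → ℝ) : Set V := {x | ∀ k, inner ℝ (a k) x ≤ b k}

/-- `l` is a vector of Karush-Kuhn-Tucker multipliers for the point `x` of the polyhedron with
right-hand side `b`, where `v` is the value of the operator at `x`. -/
structure IsKKT (a : ι → V) (b : ι → ℝ) (x v : V) (l : ι → ℝ) : Prop where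
  nonneg : ∀ k, 0 ≤ l k
  sum_eq : ∑ k, l k • a k = -v
  compl : ∀ k, l k * (b k - inner ℝ (a k) x) = 0

theorem IsVISol.exists_isKKT [FiniteDimensional ℝ V] {a : ι → V} {b : ι → ℝ} {g : V → V} {x : V}
    (h : IsVISol g (polyhedron a b) x) : ∃ l, IsKKT a b x (g x) l := by
  classical
  -- Farkas' lemma is applied to the active constraints only
  let a' : ι → V := fun k => if inner ℝ (a k) x = b k then a k else 0
  obtain ⟨c, hc, hsum⟩ := farkas a' (-g x) (by
    intro d hd
    have hev : ∀ᶠ t in nhdsWithin (0 : ℝ) (Set.Ioi 0), x + t • d ∈ polyhedron a b := by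
      simp only [polyhedron, Set.mem_ofPred_eq, Filter.eventually_all]
      intro k
      by_cases hk : inner ℝ (a k) x = b k
      · filter_upwards [self_mem_nhdsWithin] with t ht
        have := hd k
        simp only [a', if_pos hk] at this
        rw [inner_add_right, inner_smul_right, hk]
        have := mul_nonpos_of_nonneg_of_nonpos (le_of_lt ht) this
        linarith
      · have hlt : inner ℝ (a k) x < b k := lt_of_le_of_ne (h.1 k) hk
        have hcont : Continuous fun t : ℝ => inner ℝ (a k) (x + t • d) := by fun_prop
        have := hcont.tendsto 0
        simp only [zero_smul, add_zero] at this
        exact ((this.eventually (gt_mem_nhds hlt)).filter_mono nhdsWithin_le_nhds).mono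
          fun t ht => le_of_lt ht
    obtain ⟨t, ht, ht0⟩ := (hev.and self_mem_nhdsWithin).exists
    have := h.2 _ ht
    rw [add_sub_cancel_left, inner_smul_right] at this
    have := nonneg_of_mul_nonneg_right this ht0
    rw [inner_neg_left]
    linarith)
  refine ⟨fun k => if inner ℝ (a k) x = b k then c k else 0, ?_, ?_, ?_⟩
  · intro k
    split_ifs
    exacts [hc k, le_rfl]
  · rw [← hsum]
    refine Finset.sum_congr rfl fun k _ => ?_
    simp only [a']
    split_ifs <;> simp
  · intro k
    split_ifs with hk
    · rw [hk, sub_self, mul_zero]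
    · rw [zero_mul]

/-- The basic estimate of sensitivity analysis: the distance of two solutions is controlled by the
product of the distance of their multipliers and the distance of the right-hand sides. -/
theorem IsKKT.norm_sub_sq_le {a : ι → V} {b b' : ι → ℝ} {x x' : V} {l l' : ι → ℝ} {g : V → V}
    {γ : ℝ} (hg : StronglyMonotone g γ) (h : IsKKT a b x (g x) l) (h' : IsKKT a b' x' (g x') l')
    (hx : x ∈ polyhedron a b) (hx' : x' ∈ polyhedron a b') :
    γ * ‖x - x'‖ ^ 2 ≤ Fintype.card ι * (‖l - l'‖ * ‖b - b'‖) := by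
  have h1 := hg x x'
  have h2 : inner ℝ (g x - g x') (x - x') =
      ∑ k, (l' k - l k) * (inner ℝ (a k) x - inner ℝ (a k) x') := by
    have : g x - g x' = ∑ k, (l' k - l k) • a k := by
      simp only [sub_smul, Finset.sum_sub_distrib, h.sum_eq, h'.sum_eq]
      abel
    rw [this, sum_inner]
    refine Finset.sum_congr rfl fun k _ => ?_
    rw [real_inner_smul_left, inner_sub_right]
  have h3 : ∀ k, (l' k - l k) * (inner ℝ (a k) x - inner ℝ (a k) x') ≤ ‖l - l'‖ * ‖b - b'‖ := by
    intro k
    have e1 := h.compl k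
    have e2 := h'.compl k
    have e3 := mul_nonneg (h.nonneg k) (sub_nonneg.2 (hx' k))
    have e4 := mul_nonneg (h'.nonneg k) (sub_nonneg.2 (hx k))
    have e5 : (l' k - l k) * (inner ℝ (a k) x - inner ℝ (a k) x') ≤
        -((l - l') k * (b - b') k) := by
      simp only [Pi.sub_apply]
      linarith
    refine e5.trans ((neg_le_abs _).trans ?_)
    rw [abs_mul]
    exact mul_le_mul (norm_le_pi_norm (l - l') k) (norm_le_pi_norm (b - b') k) (abs_nonneg _)
      (norm_nonneg _)
  calc γ * ‖x - x'‖ ^ 2 ≤ _ := h1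
    _ = _ := h2
    _ ≤ ∑ _k : ι, ‖l - l'‖ * ‖b - b'‖ := Finset.sum_le_sum fun k _ => h3 k
    _ = _ := by simp

variable [FiniteDimensional ℝ V]

/-- **Lipschitz stability of polyhedral variational inequalities**: along a segment of right-hand
sides for which solutions exist, the solution is Lipschitz, with a constant that depends only on
the constraint normals, the modulus of monotonicity and the Lipschitz constant of the operator.

The multipliers are given by finitely many linear maps, so a small displacement along the segment
keeps one of these maps valid at both ends; then the multipliers differ by at most a multiple of
the displacement of the solution, and one factor of it cancels in `IsKKT.norm_sub_sq_le`. -/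
theorem exists_lipschitz_polyhedral_VI (a : ι → V) {γ L : ℝ} (hγ : 0 < γ) (hL : 0 ≤ L) :
    ∃ C : ℝ, 0 < C ∧ ∀ (g : V → V), (∀ x x', ‖g x - g x'‖ ≤ L * ‖x - x'‖) →
      StronglyMonotone g γ → ∀ b₀ b₁ : ι → ℝ,
      (∀ s ∈ Set.Icc (0 : ℝ) 1, ∃ x, IsVISol g (polyhedron a (b₀ + s • (b₁ - b₀))) x) →
      ∀ x₀ x₁, IsVISol g (polyhedron a b₀) x₀ → IsVISol g (polyhedron a b₁) x₁ →
      ‖x₁ - x₀‖ ≤ C * ‖b₁ - b₀‖ := by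
  obtain ⟨𝒯, hfin, h𝒯⟩ := exists_finite_conic_coordinates a
  obtain ⟨M, hM0, hM⟩ : ∃ M : ℝ, 0 ≤ M ∧ ∀ T ∈ 𝒯, ‖T‖ ≤ M := by
    obtain ⟨M, hM⟩ := (hfin.image fun T => ‖T‖).bddAbove
    exact ⟨max M 0, le_max_right _ _, fun T hT => (hM ⟨T, hT, rfl⟩).trans (le_max_left _ _)⟩
  set N : ℝ := (Fintype.card ι : ℝ) with hN
  have hN0 : 0 ≤ N := Nat.cast_nonneg _
  set C₀ := N * M * L / γ with hC₀
  have hC₀0 : 0 ≤ C₀ := by positivity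
  refine ⟨C₀ + 1, by positivity, fun g hgL hg b₀ b₁ hex x₀ x₁ hx₀ hx₁ => ?_⟩
  have hgc : Continuous g := (LipschitzWith.of_dist_le_mul (K := ⟨L, hL⟩) fun x y => by
    rw [dist_eq_norm, dist_eq_norm]; exact hgL x y).continuous
  rcases (norm_nonneg (b₁ - b₀)).eq_or_lt with hδ | hδ
  · have : b₁ = b₀ := sub_eq_zero.1 (norm_eq_zero.1 hδ.symm)
    subst this
    rw [hx₁.unique hγ hg hx₀]
    simp
  set δ := ‖b₁ - b₀‖ with hδdef
  set b : ℝ → ι → ℝ := fun s => b₀ + s • (b₁ - b₀) with hb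
  have hbb : ∀ s s', ‖b s - b s'‖ = |s - s'| * δ := by
    intro s s'
    rw [show b s - b s' = (s - s') • (b₁ - b₀) by simp only [hb, sub_smul]; abel, norm_smul,
      Real.norm_eq_abs]
  choose! x hx using hex
  have hkkt : ∀ s ∈ Set.Icc (0 : ℝ) 1, ∃ T ∈ 𝒯, IsKKT a (b s) (x s) (g (x s)) (T (-g (x s))) := by
    intro s hs
    obtain ⟨l, hl⟩ := (hx s hs).exists_isKKT
    obtain ⟨T, hT, h1, h2, h3⟩ := h𝒯 l hl.nonneg
    rw [hl.sum_eq] at h1 h2 h3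
    refine ⟨T, hT, h1, h2, fun k => ?_⟩
    rcases mul_eq_zero.1 (hl.compl k) with h | h
    · rw [h3 k h, zero_mul]
    · rw [h, mul_zero]
  have hTn : ∀ T ∈ 𝒯, ∀ v, ‖T v‖ ≤ M * ‖v‖ := fun T hT v =>
    (T.le_opNorm v).trans (mul_le_mul_of_nonneg_right (hM T hT) (norm_nonneg v))
  -- continuity of the solution along the segment, from the crude bound on the multipliers
  have hcont : ContinuousOn x (Set.Icc 0 1) := by
    intro s hs
    rw [ContinuousWithinAt, tendsto_iff_norm_sub_tendsto_zero]
    set G := ‖g (x s)‖ with hG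
    have hbound : ∀ s' ∈ Set.Icc (0 : ℝ) 1, ‖x s' - x s‖ ≤
        √(2 / γ * (2 * G * (N * M * (|s' - s| * δ)) +
          (N * M * (|s' - s| * δ)) ^ 2 * L ^ 2 / (2 * γ))) := by
      intro s' hs'
      apply Real.le_sqrt_of_sq_le
      obtain ⟨T, hT, hk⟩ := hkkt s hs
      obtain ⟨T', hT', hk'⟩ := hkkt s' hs'
      have h1 := hk'.norm_sub_sq_le hg hk (hx s' hs').1 (hx s hs).1
      rw [hbb] at h1
      set D := ‖x s' - x s‖ with hD
      have h2 : ‖T' (-g (x s')) - T (-g (x s))‖ ≤ M * (2 * G + L * D) := by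
        have e1 := hTn T hT (-g (x s))
        have e2 := hTn T' hT' (-g (x s'))
        rw [norm_neg] at e1 e2
        have e3 : ‖g (x s')‖ ≤ G + L * D := by
          have := norm_add_le (g (x s)) (g (x s') - g (x s))
          rw [add_sub_cancel] at this
          linarith [hgL (x s') (x s)]
        have e4 := mul_le_mul_of_nonneg_left e3 hM0
        linarith [norm_sub_le (T' (-g (x s'))) (T (-g (x s)))]
      set κ := N * M * (|s' - s| * δ) with hκ
      have h3 : γ * D ^ 2 ≤ κ * (2 * G + L * D) := by
        refine h1.trans ?_
        have : N * (M * (2 * G + L * D) * (|s' - s| * δ)) = κ * (2 * G + L * D) := by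
          rw [hκ]; ring
        rw [← this]
        gcongr
      have h4 : κ * (L * D) ≤ γ / 2 * D ^ 2 + κ ^ 2 * L ^ 2 / (2 * γ) := by
        have : γ / 2 * D ^ 2 + κ ^ 2 * L ^ 2 / (2 * γ) - κ * (L * D) =
            (γ * D - κ * L) ^ 2 / (2 * γ) := by field_simp; ring
        have h5 : 0 ≤ (γ * D - κ * L) ^ 2 / (2 * γ) := by positivity
        linarith
      rw [div_mul_eq_mul_div, le_div_iff₀ hγ]
      linarith
    refine squeeze_zero' (Filter.Eventually.of_forall fun _ => norm_nonneg _)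
      (Filter.eventually_of_mem self_mem_nhdsWithin hbound) ?_
    have hc : Continuous fun s' : ℝ => √(2 / γ * (2 * G * (N * M * (|s' - s| * δ)) +
          (N * M * (|s' - s| * δ)) ^ 2 * L ^ 2 / (2 * γ))) := by fun_prop
    have := hc.tendsto s
    simp only [sub_self, abs_zero, zero_mul, mul_zero, ne_eq, OfNat.ofNat_ne_zero,
      not_false_eq_true, zero_pow, zero_div, add_zero, Real.sqrt_zero] at this
    exact this.mono_left nhdsWithin_le_nhds
  -- local Lipschitz estimate: nearby points share a map `T` that gives the multipliers
  have hloc : ∀ s ∈ Set.Icc (0 : ℝ) 1, ∀ᶠ z in nhdsWithin s (Set.Icc 0 1),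
      ‖x z - x s‖ ≤ C₀ * δ * |z - s| := by
    intro s hs
    have hclosed : ∀ T : V →L[ℝ] (ι → ℝ),
        IsClosed {p : V × (ι → ℝ) | IsKKT a p.2 p.1 (g p.1) (T (-g p.1))} := by
      intro T
      have : {p : V × (ι → ℝ) | IsKKT a p.2 p.1 (g p.1) (T (-g p.1))} =
          {p | ∀ k, 0 ≤ T (-g p.1) k} ∩ ({p | ∑ k, T (-g p.1) k • a k = -g p.1} ∩
            {p | ∀ k, T (-g p.1) k * (p.2 k - inner ℝ (a k) p.1) = 0}) := by
        ext p
        exact ⟨fun h => ⟨h.1, h.2, h.3⟩, fun h => ⟨h.1, h.2.1, h.2.2⟩⟩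
      rw [this]
      refine IsClosed.inter ?_ (IsClosed.inter (isClosed_eq (by fun_prop) (by fun_prop)) ?_)
      · simp only [Set.ofPred_forall]
        exact isClosed_iInter fun k => isClosed_le continuous_const (by fun_prop)
      · simp only [Set.ofPred_forall]
        exact isClosed_iInter fun k => isClosed_eq (by fun_prop) continuous_const
    have hpc : ContinuousWithinAt (fun z => (x z, b z)) (Set.Icc 0 1) s :=
      (hcont s hs).prodMk (Continuous.continuousWithinAt (by fun_prop))
    have hev : ∀ T ∈ 𝒯, ∀ᶠ z in nhdsWithin s (Set.Icc 0 1),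
        IsKKT a (b z) (x z) (g (x z)) (T (-g (x z))) →
          IsKKT a (b s) (x s) (g (x s)) (T (-g (x s))) := by
      intro T _
      by_cases hT : IsKKT a (b s) (x s) (g (x s)) (T (-g (x s)))
      · exact Filter.Eventually.of_forall fun _ _ => hT
      · have := hpc.eventually ((hclosed T).isOpen_compl.mem_nhds hT)
        exact this.mono fun z hz hz' => absurd hz' hz
    filter_upwards [(Filter.eventually_all_finite hfin).2 hev, self_mem_nhdsWithin] with z hz hzI
    obtain ⟨T, hT, hk⟩ := hkkt z hzI
    have h1 := hk.norm_sub_sq_le hg (hz T hT hk) (hx z hzI).1 (hx s hs).1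
    rw [hbb, ← map_sub, neg_sub_neg] at h1
    have h2 := hTn T hT (g (x s) - g (x z))
    rw [norm_sub_rev (g (x s))] at h2
    have h3 := hgL (x z) (x s)
    set D := ‖x z - x s‖ with hD
    have h4 : γ * D ^ 2 ≤ N * (M * (L * D) * (|z - s| * δ)) := by
      refine h1.trans ?_
      gcongr
      exact h2.trans (mul_le_mul_of_nonneg_left h3 hM0)
    rw [hC₀, div_mul_eq_mul_div, div_mul_eq_mul_div, le_div_iff₀ hγ]
    rcases (norm_nonneg (x z - x s)).eq_or_lt with h0 | h0
    · rw [hD, ← h0, zero_mul]; positivity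
    · exact le_of_mul_le_mul_right (by rw [← hD]; linarith) h0
  have hfence := image_norm_le_of_liminf_right_slope_norm_lt_deriv_boundary
    (f := fun s => x s - x 0) (f' := fun _ => C₀ * δ) (a := 0) (b := 1)
    (B := fun s => (C₀ + 1) * δ * s) (B' := fun _ => (C₀ + 1) * δ)
    (hcont.sub continuousOn_const) (by
      intro s hs r hr
      refine Filter.Eventually.frequently ?_
      have hsub : nhdsWithin s (Set.Ioi s) ≤ nhdsWithin s (Set.Icc 0 1) := by
        rw [← nhdsWithin_Ioc_eq_nhdsGT hs.2]
        exact nhdsWithin_mono _ fun z hz => ⟨hs.1.trans hz.1.le, hz.2⟩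
      filter_upwards [hsub (hloc s ⟨hs.1, hs.2.le⟩), self_mem_nhdsWithin] with z hz hzs
      have hzs' : 0 < z - s := sub_pos.2 hzs
      refine lt_of_le_of_lt ?_ hr
      rw [slope_def_field, div_le_iff₀ hzs']
      rw [abs_of_pos hzs'] at hz
      have := norm_sub_norm_le (x z - x 0) (x s - x 0)
      rw [sub_sub_sub_cancel_right] at this
      exact this.trans hz) (by simp) (by fun_prop)
    (fun s _ => by simpa using ((hasDerivAt_id s).const_mul ((C₀ + 1) * δ)).hasDerivWithinAt)
    (fun s _ _ => by nlinarith)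
  have h1 := hfence (Set.right_mem_Icc.2 zero_le_one)
  have e0 : x 0 = x₀ := (hx 0 (by simp)).unique hγ hg (by simpa using hx₀)
  have e1 : x 1 = x₁ := (hx 1 (by simp)).unique hγ hg (by simpa using hx₁)
  rw [e0, e1, mul_one] at h1
  exact h1

end Polyhedron

/-! ### The proximal augmented Lagrangian and its minimizers -/

namespace LinConProblem

open ContinuousLinearMap (adjoint)

variable {n m p : ℕ} (pb : LinConProblem n m p)

/-- The gradient of `x ↦ K(x, y, z)`. -/
def proxGrad (ρ μ : ℝ) (y : Vec m) (z x : Vec n) : Vec n :=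
  gradient pb.f x + adjoint pb.A y + ρ • adjoint pb.A (pb.A x - pb.b) + μ • (x - z)

/-- The gradient of the primal proximal objective `x ↦ f(x) + (μ/2)‖x - z‖²`. -/
def primalGrad (μ : ℝ) (z x : Vec n) : Vec n := gradient pb.f x + μ • (x - z)

theorem isClosed_X : IsClosed pb.X := by
  simp only [X, Set.ofPred_forall]
  exact isClosed_iInter fun i => isClosed_le (by fun_prop) continuous_const

theorem convex_X : Convex ℝ pb.X := by
  intro x hx y hy s t hs ht hst i
  have h1 := mul_le_mul_of_nonneg_left (hx i) hs
  have h2 := mul_le_mul_of_nonneg_left (hy i) ht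
  have h3 : s * pb.h i + t * pb.h i = pb.h i := by rw [← add_mul, hst, one_mul]
  simp only [map_add, map_smul, PiLp.add_apply, PiLp.smul_apply, smul_eq_mul]
  linarith

theorem isClosed_feasible : IsClosed pb.feasible :=
  pb.isClosed_X.inter (isClosed_eq (by fun_prop) continuous_const)

theorem convex_feasible : Convex ℝ pb.feasible := by
  intro x hx y hy s t hs ht hst
  refine ⟨pb.convex_X hx.1 hy.1 hs ht hst, ?_⟩
  rw [map_add, map_smul, map_smul, hx.2, hy.2, ← add_smul, hst, one_smul]

variable {pb} {Lf ρ μ : ℝ}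

theorem Regular.X_nonempty (h : pb.Regular Lf) : pb.X.Nonempty :=
  h.feasible_nonempty.mono fun _ hx => hx.1

theorem Regular.hasGradientAt (h : pb.Regular Lf) (x : Vec n) :
    HasGradientAt pb.f (gradient pb.f x) x :=
  (h.differentiable x).hasGradientAt

theorem Regular.continuous_gradient (h : pb.Regular Lf) (hLf : 0 ≤ Lf) :
    Continuous (gradient pb.f) :=
  (LipschitzWith.of_dist_le_mul (K := ⟨Lf, hLf⟩) fun x y => by
    rw [dist_eq_norm, dist_eq_norm]; exact h.gradient_lipschitz x y).continuous

theorem Regular.primal_hasGradientAt (h : pb.Regular Lf) (z x : Vec n) :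
    HasGradientAt (fun x => pb.f x + μ / 2 * ‖x - z‖ ^ 2) (pb.primalGrad μ z x) x := by
  have h1 := h.hasGradientAt x
  have h2 := hasGradientAt_half_norm_sub_sq μ z x
  rw [hasGradientAt_iff_hasFDerivAt] at h1 h2 ⊢
  rw [primalGrad, map_add]
  exact h1.add h2

theorem Regular.proxAL_hasGradientAt (h : pb.Regular Lf) (y : Vec m) (z x : Vec n) :
    HasGradientAt (fun x => pb.proxAL ρ μ x y z) (pb.proxGrad ρ μ y z x) x := by
  have h1 := h.hasGradientAt x
  have h2 := hasGradientAt_half_norm_sub_sq μ z x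
  rw [hasGradientAt_iff_hasFDerivAt] at h1 h2 ⊢
  have hA : HasFDerivAt (fun x => pb.A x - pb.b) pb.A x := pb.A.hasFDerivAt.sub_const _
  have h3 := hA.inner ℝ (hasFDerivAt_const y x)
  have h4 := hA.norm_sq.const_mul (ρ / 2)
  refine (((h1.add h3).add h4).add h2).congr_fderiv ?_
  ext v
  simp [proxGrad, ContinuousLinearMap.adjoint_inner_left, real_inner_comm]
  ring

theorem Regular.primalGrad_stronglyMonotone (h : pb.Regular Lf) (hμ : 4 * Lf ≤ μ) (z : Vec n) :
    StronglyMonotone (pb.primalGrad μ z) (3 / 4 * μ) := by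
  intro x x'
  have h1 := h.gradient_lipschitz x x'
  have h2 := (abs_le.1 (abs_real_inner_le_norm (gradient pb.f x - gradient pb.f x') (x - x'))).1
  have h3 : pb.primalGrad μ z x - pb.primalGrad μ z x' =
      (gradient pb.f x - gradient pb.f x') + μ • (x - x') := by
    simp only [primalGrad, smul_sub]; abel
  rw [h3, inner_add_left, real_inner_smul_left, real_inner_self_eq_norm_sq]
  nlinarith [norm_nonneg (x - x'), mul_le_mul_of_nonneg_right h1 (norm_nonneg (x - x')),
    mul_nonneg (sub_nonneg.2 hμ) (sq_nonneg ‖x - x'‖)]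

theorem primalGrad_lipschitz (h : pb.Regular Lf) (hμ : 0 ≤ μ) (z x x' : Vec n) :
    ‖pb.primalGrad μ z x - pb.primalGrad μ z x'‖ ≤ (Lf + μ) * ‖x - x'‖ := by
  have h3 : pb.primalGrad μ z x - pb.primalGrad μ z x' =
      (gradient pb.f x - gradient pb.f x') + μ • (x - x') := by
    simp only [primalGrad, smul_sub]; abel
  rw [h3, add_mul]
  refine (norm_add_le _ _).trans (add_le_add (h.gradient_lipschitz x x') ?_)
  rw [norm_smul, Real.norm_of_nonneg hμ]

theorem proxGrad_eq (y : Vec m) (z x : Vec n) : pb.proxGrad ρ μ y z x =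
    pb.primalGrad μ z x + adjoint pb.A (y + ρ • (pb.A x - pb.b)) := by
  simp only [proxGrad, primalGrad, map_add, map_smul]; abel

theorem proxGrad_sub (y : Vec m) (z x x' : Vec n) :
    pb.proxGrad ρ μ y z x - pb.proxGrad ρ μ y z x' =
    (pb.primalGrad μ z x - pb.primalGrad μ z x') + ρ • adjoint pb.A (pb.A (x - x')) := by
  rw [proxGrad_eq, proxGrad_eq]
  simp only [map_add, map_smul, map_sub, smul_sub]; abel

theorem Regular.proxGrad_stronglyMonotone (h : pb.Regular Lf) (hμ : 4 * Lf ≤ μ) (hρ : 0 ≤ ρ)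
    (y : Vec m) (z : Vec n) : StronglyMonotone (pb.proxGrad ρ μ y z) (3 / 4 * μ) := by
  intro x x'
  rw [proxGrad_sub, inner_add_left, real_inner_smul_left, ContinuousLinearMap.adjoint_inner_left,
    real_inner_self_eq_norm_sq]
  have := h.primalGrad_stronglyMonotone hμ z x x'
  have : 0 ≤ ρ * ‖pb.A (x - x')‖ ^ 2 := by positivity
  linarith

theorem norm_adjoint_apply_le (A : Vec n →L[ℝ] Vec m) (y : Vec m) : ‖adjoint A y‖ ≤ ‖A‖ * ‖y‖ := by
  have := (adjoint A).le_opNorm y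
  rwa [LinearIsometryEquiv.norm_map] at this

theorem proxGrad_lipschitz (h : pb.Regular Lf) (hμ : 0 ≤ μ) (hρ : 0 ≤ ρ)
    (y : Vec m) (z x x' : Vec n) :
    ‖pb.proxGrad ρ μ y z x - pb.proxGrad ρ μ y z x'‖ ≤
      (Lf + ρ * ‖pb.A‖ ^ 2 + μ) * ‖x - x'‖ := by
  rw [proxGrad_sub]
  have h1 := primalGrad_lipschitz h hμ z x x'
  have h2 : ‖adjoint pb.A (pb.A (x - x'))‖ ≤ ‖pb.A‖ * (‖pb.A‖ * ‖x - x'‖) :=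
    (norm_adjoint_apply_le _ _).trans
      (mul_le_mul_of_nonneg_left (pb.A.le_opNorm _) (norm_nonneg _))
  have h3 := norm_add_le (pb.primalGrad μ z x - pb.primalGrad μ z x')
    (ρ • adjoint pb.A (pb.A (x - x')))
  rw [norm_smul, Real.norm_of_nonneg hρ] at h3
  have h4 := mul_le_mul_of_nonneg_left h2 hρ
  linarith

section Minimizers

variable (h : pb.Regular Lf) (hμ : 4 * Lf ≤ μ) (hμ0 : 0 < μ) (hρ : 0 ≤ ρ)
include h hμ hμ0

theorem xBarStar_spec (z : Vec n) : pb.xBarStar μ z ∈ pb.feasible ∧ ∀ v ∈ pb.feasible,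
    pb.f (pb.xBarStar μ z) + μ / 2 * ‖pb.xBarStar μ z - z‖ ^ 2 ≤ pb.f v + μ / 2 * ‖v - z‖ ^ 2 :=
  argminOn_spec <| (h.primalGrad_stronglyMonotone hμ z).exists_isMin (by positivity)
    (h.primal_hasGradientAt z) pb.isClosed_feasible h.feasible_nonempty

theorem xBarStar_isVISol (z : Vec n) :
    IsVISol (pb.primalGrad μ z) pb.feasible (pb.xBarStar μ z) :=
  isVISol_of_isMin (h.primal_hasGradientAt z) pb.convex_feasible (xBarStar_spec h hμ hμ0 z).1
    (xBarStar_spec h hμ hμ0 z).2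

theorem norm_xBarStar_sub_le (z z' : Vec n) :
    ‖pb.xBarStar μ z - pb.xBarStar μ z'‖ ≤ 4 / 3 * ‖z - z'‖ := by
  have h1 := (xBarStar_isVISol h hμ hμ0 z).norm_sub_le (h.primalGrad_stronglyMonotone hμ z)
    (xBarStar_isVISol h hμ hμ0 z')
  have h2 : pb.primalGrad μ z (pb.xBarStar μ z') - pb.primalGrad μ z' (pb.xBarStar μ z') =
      μ • (z' - z) := by
    simp only [primalGrad, smul_sub]; abel
  rw [h2, norm_smul, Real.norm_of_nonneg hμ0.le, norm_sub_rev z'] at h1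
  have : μ * (3 / 4 * ‖pb.xBarStar μ z - pb.xBarStar μ z'‖) ≤ μ * ‖z - z'‖ := by linarith
  have := le_of_mul_le_mul_left this hμ0
  linarith

theorem continuous_xBarStar : Continuous (pb.xBarStar μ) :=
  (LipschitzWith.of_dist_le_mul (K := 4 / 3) fun z z' => by
    simpa [dist_eq_norm] using norm_xBarStar_sub_le h hμ hμ0 z z').continuous

include hρ

theorem xStar_spec (y : Vec m) (z : Vec n) : pb.xStar ρ μ y z ∈ pb.X ∧ ∀ v ∈ pb.X,
    pb.proxAL ρ μ (pb.xStar ρ μ y z) y z ≤ pb.proxAL ρ μ v y z :=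
  argminOn_spec <| (h.proxGrad_stronglyMonotone hμ hρ y z).exists_isMin (by positivity)
    (h.proxAL_hasGradientAt y z) pb.isClosed_X h.X_nonempty

theorem xStar_isVISol (y : Vec m) (z : Vec n) :
    IsVISol (pb.proxGrad ρ μ y z) pb.X (pb.xStar ρ μ y z) :=
  isVISol_of_isMin (h.proxAL_hasGradientAt y z) pb.convex_X (xStar_spec h hμ hμ0 hρ y z).1
    (xStar_spec h hμ hμ0 hρ y z).2

theorem norm_xStar_sub_le (y y' : Vec m) (z z' : Vec n) :
    3 / 4 * μ * ‖pb.xStar ρ μ y z - pb.xStar ρ μ y' z'‖ ≤ ‖pb.A‖ * ‖y - y'‖ + μ * ‖z - z'‖ := by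
  have h1 := (xStar_isVISol h hμ hμ0 hρ y z).norm_sub_le (h.proxGrad_stronglyMonotone hμ hρ y z)
    (xStar_isVISol h hμ hμ0 hρ y' z')
  have h2 : pb.proxGrad ρ μ y z (pb.xStar ρ μ y' z') -
      pb.proxGrad ρ μ y' z' (pb.xStar ρ μ y' z') = adjoint pb.A (y - y') + μ • (z' - z) := by
    simp only [proxGrad, smul_sub, map_sub]; abel
  rw [h2] at h1
  refine h1.trans ((norm_add_le _ _).trans (add_le_add (norm_adjoint_apply_le _ _) ?_))
  rw [norm_smul, Real.norm_of_nonneg hμ0.le, norm_sub_rev]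

theorem continuous_xStar : Continuous fun q : Vec m × Vec n => pb.xStar ρ μ q.1 q.2 := by
  rw [continuous_iff_continuousAt]
  rintro ⟨y, z⟩
  rw [ContinuousAt, tendsto_iff_norm_sub_tendsto_zero]
  have hc : Continuous fun q : Vec m × Vec n =>
      (‖pb.A‖ * ‖q.1 - y‖ + μ * ‖q.2 - z‖) / (3 / 4 * μ) := by fun_prop
  have := hc.tendsto (y, z)
  simp only [sub_self, norm_zero, mul_zero, add_zero, zero_div] at this
  refine squeeze_zero (fun _ => norm_nonneg _) (fun q => ?_) this
  rw [le_div_iff₀ (by positivity), mul_comm]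
  exact norm_xStar_sub_le h hμ hμ0 hρ q.1 y q.2 z

end Minimizers

/-! ### The global error bound -/

/-- The normals of the constraints `A x = b`, `H x ≤ h`, written as inequalities. -/
def constraintNormal (A : Vec n →L[ℝ] Vec m) (H : Vec n →L[ℝ] Vec p) :
    Fin m ⊕ Fin m ⊕ Fin p → Vec n :=
  Sum.elim (fun i => adjoint A (EuclideanSpace.single i 1))
    (Sum.elim (fun i => -adjoint A (EuclideanSpace.single i 1))
      (fun j => adjoint H (EuclideanSpace.single j 1)))

/-- The right-hand sides of the constraints `A x = b + r`, `H x ≤ h`, written as inequalities. -/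
def constraintRhs (b : Vec m) (h : Vec p) (r : Vec m) : Fin m ⊕ Fin m ⊕ Fin p → ℝ :=
  Sum.elim (fun i => b i + r i) (Sum.elim (fun i => -(b i + r i)) (fun j => h j))

theorem mem_polyhedron_constraint {r : Vec m} {x : Vec n} :
    x ∈ polyhedron (constraintNormal pb.A pb.H) (constraintRhs pb.b pb.h r) ↔
      x ∈ pb.X ∧ pb.A x = pb.b + r := by
  simp only [polyhedron, Set.mem_ofPred_eq, Sum.forall, constraintNormal, constraintRhs,
    Sum.elim_inl, Sum.elim_inr, inner_neg_left, ContinuousLinearMap.adjoint_inner_left, X]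
  simp only [EuclideanSpace.inner_single_left, map_one, one_mul, neg_le_neg_iff]
  constructor
  · rintro ⟨h1, h2, h3⟩
    refine ⟨h3, ?_⟩
    ext i
    exact le_antisymm (h1 i) (h2 i)
  · rintro ⟨h1, h2⟩
    simp only [h2]
    exact ⟨fun i => le_rfl, fun i => le_rfl, h1⟩

theorem constraintRhs_segment (b : Vec m) (h : Vec p) (r : Vec m) (s : ℝ) :
    constraintRhs b h 0 + s • (constraintRhs b h r - constraintRhs b h 0) =
      constraintRhs b h (s • r) := by
  ext (i | i | j) <;> simp [constraintRhs]; ring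

theorem norm_constraintRhs_sub_le (b : Vec m) (h : Vec p) (r : Vec m) :
    ‖constraintRhs b h r - constraintRhs b h 0‖ ≤ ‖r‖ := by
  rw [pi_norm_le_iff_of_nonneg (norm_nonneg _)]
  rintro (i | i | j)
  · simpa [constraintRhs] using PiLp.norm_apply_le r i
  · simpa [constraintRhs] using PiLp.norm_apply_le r i
  · simp [constraintRhs]

/-- The global error bound, with a constant that depends only on `A`, `H`, `Lf` and `μ`: with
`r = A x*(y, z) - b`, both `x*(y, z)` and `x̄*(z)` solve the variational inequality of
`f + (μ/2)‖· - z‖²`, over `{x ∈ X : A x = b + r}` and `{x ∈ X : A x = b}` respectively, so that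
the Lipschitz stability of polyhedral variational inequalities applies. -/
theorem exists_isErrorBoundConst (A : Vec n →L[ℝ] Vec m) (H : Vec n →L[ℝ] Vec p)
    (hLf : 0 ≤ Lf) (hμ : 4 * Lf ≤ μ) (hμ0 : 0 < μ) (hρ : 0 ≤ ρ) :
    ∃ σ₀ : ℝ, 0 < σ₀ ∧ ∀ pb : LinConProblem n m p, pb.A = A → pb.H = H → pb.Regular Lf →
      pb.IsErrorBoundConst ρ μ σ₀ := by
  obtain ⟨C, hC, hlip⟩ := exists_lipschitz_polyhedral_VI (constraintNormal A H)
    (γ := 3 / 4 * μ) (L := Lf + μ) (by positivity) (by positivity)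
  refine ⟨C, hC, ?_⟩
  rintro pb rfl rfl h y z
  set r := pb.A (pb.xStar ρ μ y z) - pb.b with hr
  have hx := xStar_isVISol h hμ hμ0 hρ y z
  have hxb := xBarStar_isVISol h hμ hμ0 z
  have hconv : ∀ r, Convex ℝ (polyhedron (constraintNormal pb.A pb.H)
      (constraintRhs pb.b pb.h r)) := by
    intro r x hx x' hx' s t hs ht hst
    rw [mem_polyhedron_constraint] at hx hx' ⊢
    refine ⟨pb.convex_X hx.1 hx'.1 hs ht hst, ?_⟩
    rw [map_add, map_smul, map_smul, hx.2, hx'.2, ← add_smul, hst, one_smul]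
  have hclosed : ∀ r, IsClosed (polyhedron (constraintNormal pb.A pb.H)
      (constraintRhs pb.b pb.h r)) := by
    intro r
    simp only [polyhedron, Set.ofPred_forall]
    exact isClosed_iInter fun k => isClosed_le (by fun_prop) continuous_const
  refine (hlip (pb.primalGrad μ z) (primalGrad_lipschitz h hμ0.le z)
    (h.primalGrad_stronglyMonotone hμ z) (constraintRhs pb.b pb.h 0) (constraintRhs pb.b pb.h r)
    ?_ _ _ ?_ ?_).trans (mul_le_mul_of_nonneg_left (norm_constraintRhs_sub_le _ _ _) hC.le)
  · intro s hs
    rw [constraintRhs_segment]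
    have hne : (polyhedron (constraintNormal pb.A pb.H)
        (constraintRhs pb.b pb.h (s • r))).Nonempty := by
      refine ⟨(1 - s) • pb.xBarStar μ z + s • pb.xStar ρ μ y z, ?_⟩
      rw [mem_polyhedron_constraint]
      refine ⟨pb.convex_X hxb.1.1 hx.1 (by linarith [hs.2]) hs.1 (by ring), ?_⟩
      rw [map_add, map_smul, map_smul, hxb.1.2, hr, smul_sub, sub_smul, one_smul]
      abel
    obtain ⟨u, hu, hmin⟩ := (h.primalGrad_stronglyMonotone hμ z).exists_isMin (by positivity)
      (h.primal_hasGradientAt z) (hclosed (s • r)) hne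
    exact ⟨u, isVISol_of_isMin (h.primal_hasGradientAt z) (hconv _) hu hmin⟩
  · refine ⟨mem_polyhedron_constraint.2 ⟨hxb.1.1, by rw [hxb.1.2, add_zero]⟩, fun v hv => ?_⟩
    rw [mem_polyhedron_constraint, add_zero] at hv
    exact hxb.2 v hv
  · refine ⟨mem_polyhedron_constraint.2 ⟨hx.1, by rw [hr]; abel⟩, fun v hv => ?_⟩
    rw [mem_polyhedron_constraint] at hv
    have h1 := hx.2 v hv.1
    -- the multiplier term vanishes because `A v = A x*(y, z)`
    have h2 : pb.A (v - pb.xStar ρ μ y z) = 0 := by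
      rw [map_sub, hv.2, hr]; abel
    rwa [proxGrad_eq, inner_add_left, ContinuousLinearMap.adjoint_inner_left, h2, inner_zero_right,
      add_zero] at h1

end LinConProblem

/-! ### The potential and its decrease in one iteration -/

/-- The step-size conditions on which the one-step decrease of the potential rests, where `a = ‖A‖`
and `lam` bounds the Lipschitz constant of the gradient of `K(·, y, z)`. -/
structure StepSizes (μ lam a σbar τ η β : ℝ) : Prop where
  two_le_μ : 2 ≤ μ
  μ_le_lam : μ ≤ lam
  a_nonneg : 0 ≤ a
  τ_pos : 0 < τ
  η_pos : 0 < η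
  β_pos : 0 < β
  τ_le : 6 * (τ * lam ^ 2) ≤ 1
  η_le : 200 * (η * a ^ 2) ≤ τ
  β_le_τ : 100 * β ≤ τ
  β_le_η : 36 * (μ * σbar ^ 2 * β) ≤ η

namespace StepSizes

variable {μ lam a σbar τ η β : ℝ} (h : StepSizes μ lam a σbar τ η β)
include h

theorem τμ_le : 12 * (τ * μ) ≤ 1 := by
  have h1 : τ * μ ≤ τ * lam := mul_le_mul_of_nonneg_left h.μ_le_lam h.τ_pos.le
  have h2 : 0 ≤ τ * lam * (lam - 2) :=
    mul_nonneg (mul_nonneg h.τ_pos.le (by linarith [h.two_le_μ, h.μ_le_lam]))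
      (by linarith [h.two_le_μ, h.μ_le_lam])
  linarith [h.τ_le]

theorem τ_le' : 24 * τ ≤ 1 := by
  have := mul_le_mul_of_nonneg_left h.two_le_μ h.τ_pos.le
  linarith [h.τμ_le]

/-- The contraction of the tracking error in one projected stochastic gradient step, after the
drift of the target has been split off by Young's inequality with weight `τμ/4`. -/
theorem tracking_le {e d₁ d₂ v : ℝ} (hv : 0 ≤ v) :
    (1 + τ * μ / 4) * ((1 - 17 / 12 * (τ * μ)) *
        ((1 + τ * μ / 4) * e ^ 2 + (1 + 4 / (τ * μ)) * d₁ ^ 2) + v) +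
      (1 + 4 / (τ * μ)) * d₂ ^ 2 ≤
    (1 - 11 / 12 * (τ * μ)) * e ^ 2 + 2 * v + 5 / (τ * μ) * (d₁ ^ 2 + d₂ ^ 2) := by
  have hu0 : 0 < τ * μ := mul_pos h.τ_pos (by linarith [h.two_le_μ])
  have hu1 := h.τμ_le
  set u := τ * μ with hu
  have h1 : (1 + u / 4) * (1 - 17 / 12 * u) * (1 + u / 4) ≤ 1 - 11 / 12 * u := by
    nlinarith [mul_pos hu0 hu0, mul_pos (mul_pos hu0 hu0) hu0]
  have h2 : (1 + u / 4) * (1 - 17 / 12 * u) ≤ 1 := by nlinarith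
  have h3 : 1 + 4 / u ≤ 5 / u := by
    rw [← sub_nonneg]
    have : 5 / u - (1 + 4 / u) = (1 - u) / u := by field_simp; ring
    rw [this]
    exact div_nonneg (by linarith) hu0.le
  have h4 : 0 ≤ 1 + 4 / u := by positivity
  have i1 := mul_le_mul_of_nonneg_right h1 (sq_nonneg e)
  have i2 := mul_le_mul_of_nonneg_right h2 (mul_nonneg h4 (sq_nonneg d₁))
  have i3 := mul_le_mul_of_nonneg_right h3 (sq_nonneg d₁)
  have i4 := mul_le_mul_of_nonneg_right h3 (sq_nonneg d₂)
  have i5 : (1 + u / 4) * v ≤ 2 * v := by nlinarith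
  linarith

/-- The numerical core of the descent estimate: all cross terms are absorbed by the negative
multiples of `e²`, `r²` and `w²`. -/
theorem descent_le {e r w q d₁ d₂ : ℝ} (hw : 0 ≤ w) (hq : 0 ≤ q)
    (hd₁ : 0 ≤ d₁) (hd₂ : 0 ≤ d₂) (hqle : q ≤ r + a * e)
    (hd₁le : 3 * μ * d₁ ≤ 4 * (a * η * q)) (hd₂le : 3 * d₂ ≤ 4 * (β * w)) :
    (1 - 11 / 12 * (τ * μ)) * e ^ 2 + 5 / (τ * μ) * (d₁ ^ 2 + d₂ ^ 2) +
      (-(η * r ^ 2) + η * a * e * r + η * a * q * (d₁ + d₂) - μ * β * w ^ 2 + μ * β * w * e +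
        2 * μ * β * σbar * w * r + μ * β * w * (d₁ + d₂) + μ * β ^ 2 / 2 * w ^ 2) ≤
    e ^ 2 - (τ * μ / 2 * e ^ 2 + η / 2 * r ^ 2 + μ * β / 4 * w ^ 2) := by
  obtain ⟨hμ, -, ha, hτ, hη, hβ, -, h7, h8, h9⟩ := id h
  have hτ' := h.τ_le'
  have hμ0 : 0 < μ := by linarith
  set g := a * η * q with hg
  have hg0 : 0 ≤ g := by positivity
  -- squares of the drifts
  have hg2 : g ^ 2 ≤ τ / 200 * (η * q ^ 2) := by
    have := mul_le_mul_of_nonneg_right h7 (show 0 ≤ η * q ^ 2 by positivity)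
    rw [hg]; linarith
  have hq2 : q ^ 2 ≤ 2 * r ^ 2 + 2 * (a ^ 2 * e ^ 2) := by
    have h1 : q ^ 2 ≤ (r + a * e) ^ 2 := by gcongr
    nlinarith [sq_nonneg (r - a * e)]
  have hηq : η * q ^ 2 ≤ 2 * (η * r ^ 2) + τ / 100 * e ^ 2 := by
    have h1 := mul_le_mul_of_nonneg_left hq2 hη.le
    have h2 := mul_le_mul_of_nonneg_right h7 (sq_nonneg e)
    linarith
  have hbw : (β * w) ^ 2 ≤ τ / 100 * (β * w ^ 2) := by
    have := mul_le_mul_of_nonneg_right h8 (show 0 ≤ β * w ^ 2 by positivity)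
    linarith
  have hd₁g : d₁ ≤ 2 / 3 * g := by
    have : 2 * d₁ ≤ μ * d₁ := mul_le_mul_of_nonneg_right hμ hd₁
    linarith
  have hd₂w : d₂ ≤ 4 / 3 * (β * w) := by linarith
  have t1 : 5 / (τ * μ) * d₁ ^ 2 ≤ η * q ^ 2 / 180 := by
    rw [div_mul_eq_mul_div, div_le_iff₀ (by positivity)]
    have e1 : (3 * μ * d₁) ^ 2 ≤ (4 * g) ^ 2 := by gcongr
    have e2 : μ ^ 2 * d₁ ^ 2 ≤ 16 / 9 * (τ / 200 * (η * q ^ 2)) := by linarith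
    have e3 : 4 * d₁ ^ 2 ≤ μ ^ 2 * d₁ ^ 2 :=
      mul_le_mul_of_nonneg_right (by nlinarith) (sq_nonneg d₁)
    have e4 : 2 * (τ * (η * q ^ 2)) ≤ μ * (τ * (η * q ^ 2)) :=
      mul_le_mul_of_nonneg_right hμ (by positivity)
    linarith
  have t2 : 5 / (τ * μ) * d₂ ^ 2 ≤ μ * β * w ^ 2 / 45 := by
    rw [div_mul_eq_mul_div, div_le_iff₀ (by positivity)]
    have e1 : (3 * d₂) ^ 2 ≤ (4 * (β * w)) ^ 2 := by gcongr
    have e2 : 2 * 2 * (τ * (β * w ^ 2)) ≤ μ * μ * (τ * (β * w ^ 2)) :=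
      mul_le_mul_of_nonneg_right (by nlinarith) (by positivity)
    linarith
  -- cross terms
  have c1 : η * a * e * r ≤ η * r ^ 2 / 4 + τ / 200 * e ^ 2 := by
    have e1 : 0 ≤ η * (r / 2 - a * e) ^ 2 := by positivity
    have e2 := mul_le_mul_of_nonneg_right h7 (sq_nonneg e)
    linarith
  have c2 : η * a * q * (d₁ + d₂) ≤ 4 / 3 * g ^ 2 + 2 / 3 * (β * w) ^ 2 := by
    have e1 : g * (d₁ + d₂) ≤ g * (2 / 3 * g + 4 / 3 * (β * w)) :=
      mul_le_mul_of_nonneg_left (by linarith) hg0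
    have e2 : η * a * q * (d₁ + d₂) = g * (d₁ + d₂) := by rw [hg]; ring
    rw [e2]
    linarith [sq_nonneg (g - β * w)]
  have c3 : μ * β * w * e ≤ μ * β * w ^ 2 / 4 + τ * μ * e ^ 2 / 100 := by
    have e1 : 0 ≤ μ * β * (w / 2 - e) ^ 2 := by positivity
    have e2 := mul_le_mul_of_nonneg_right h8 (show 0 ≤ μ * e ^ 2 by positivity)
    linarith
  have c4 : 2 * μ * β * σbar * w * r ≤ μ * β * w ^ 2 / 4 + η * r ^ 2 / 9 := by
    have e1 : 0 ≤ μ * β * (w / 2 - 2 * σbar * r) ^ 2 := by positivity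
    have e2 := mul_le_mul_of_nonneg_right h9 (sq_nonneg r)
    linarith
  have c5 : μ * β * w * (d₁ + d₂) ≤ 2 / 3 * g ^ 2 + 2 / 3 * (β * w) ^ 2 +
      4 / 3 * (μ * (β * w) ^ 2) := by
    have e1 : β * w * (μ * d₁) ≤ β * w * (4 / 3 * g) :=
      mul_le_mul_of_nonneg_left (by linarith) (by positivity)
    have e2 : μ * (β * w) * d₂ ≤ μ * (β * w) * (4 / 3 * (β * w)) :=
      mul_le_mul_of_nonneg_left (by linarith) (by positivity)
    linarith [sq_nonneg (g - β * w)]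
  have s1 : 2 * (τ * e ^ 2) ≤ μ * (τ * e ^ 2) := mul_le_mul_of_nonneg_right hμ (by positivity)
  have s2 : 2 * (β * w ^ 2) ≤ μ * (β * w ^ 2) := mul_le_mul_of_nonneg_right hμ (by positivity)
  have s3 : 24 * (g ^ 2) ≤ η * q ^ 2 / 200 := by
    have := mul_le_mul_of_nonneg_right hτ' (show 0 ≤ η * q ^ 2 by positivity)
    linarith
  have s4 : 24 * ((β * w) ^ 2) ≤ β * w ^ 2 / 100 := by
    have := mul_le_mul_of_nonneg_right hτ' (show 0 ≤ β * w ^ 2 by positivity)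
    linarith
  have s5 := mul_le_mul_of_nonneg_left s4 hμ0.le
  have p1 : 0 ≤ η * r ^ 2 := by positivity
  have p2 : 0 ≤ τ * e ^ 2 := by positivity
  have p3 : 0 ≤ β * w ^ 2 := by positivity
  linarith

end StepSizes

namespace LinConProblem

open ContinuousLinearMap (adjoint)

variable {n m p : ℕ} (pb : LinConProblem n m p)

/-- The dual function `d(y, z) = min_{x ∈ X} K(x, y, z)`. -/
def dualValue (ρ μ : ℝ) (y : Vec m) (z : Vec n) : ℝ := pb.proxAL ρ μ (pb.xStar ρ μ y z) y z

/-- The proximal value `P(z)`, the minimum of `f + (μ/2)‖· - z‖²` over the feasible set. -/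
def primalValue (μ : ℝ) (z : Vec n) : ℝ :=
  pb.f (pb.xBarStar μ z) + μ / 2 * ‖pb.xBarStar μ z - z‖ ^ 2

/-- The potential `‖x - x*(y, z)‖² - d(y, z) + 2 P(z)`. -/
def potential (ρ μ : ℝ) (q : Vec n × Vec m × Vec n) : ℝ :=
  ‖q.1 - pb.xStar ρ μ q.2.1 q.2.2‖ ^ 2 - pb.dualValue ρ μ q.2.1 q.2.2 + 2 * pb.primalValue μ q.2.2

/-- The squared distance of a state from stationarity: `‖x - x*‖² + ‖A x* - b‖² + ‖x - z‖²` with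
`x* = x*(y, z)`. -/
def residual (ρ μ : ℝ) (q : Vec n × Vec m × Vec n) : ℝ :=
  ‖q.1 - pb.xStar ρ μ q.2.1 q.2.2‖ ^ 2 + ‖pb.A (pb.xStar ρ μ q.2.1 q.2.2) - pb.b‖ ^ 2 +
    ‖q.1 - q.2.2‖ ^ 2

/-- One iteration as a map on the triples `(x, y, z)`, driven by one sample. -/
def stepMap {S : Type*} (par : AlgParams) (F : Vec n → S → Vec n) (q : Vec n × Vec m × Vec n)
    (s : S) : Vec n × Vec m × Vec n :=
  (projOn pb.X (q.1 - par.τ •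
      pb.stochGrad par.ρ par.μ F q.1 (pb.dualStep par.η q.1 q.2.1) q.2.2 s),
    pb.dualStep par.η q.1 q.2.1, q.2.2 + par.β • (q.1 - q.2.2))

variable {pb} {Lf ρ μ : ℝ}

section

variable (h : pb.Regular Lf) (hμ : 4 * Lf ≤ μ) (hμ0 : 0 < μ) (hρ : 0 ≤ ρ)
include h hμ hμ0

theorem le_primalValue {flow : ℝ} (hflow : ∀ x ∈ pb.feasible, flow ≤ pb.f x) (z : Vec n) :
    flow ≤ pb.primalValue μ z := by
  have h1 := hflow _ (xBarStar_spec h hμ hμ0 z).1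
  have h2 : 0 ≤ μ / 2 * ‖pb.xBarStar μ z - z‖ ^ 2 := by positivity
  rw [primalValue]
  linarith

theorem continuous_primalValue : Continuous (pb.primalValue μ) := by
  have h1 := continuous_xBarStar h hμ hμ0
  have h2 := h.differentiable.continuous
  unfold primalValue
  fun_prop

include hρ

theorem dualValue_le_primalValue (y : Vec m) (z : Vec n) :
    pb.dualValue ρ μ y z ≤ pb.primalValue μ z := by
  have hb := (xBarStar_spec h hμ hμ0 z).1
  have h1 := (xStar_spec h hμ hμ0 hρ y z).2 _ hb.1
  have h2 : pb.proxAL ρ μ (pb.xBarStar μ z) y z = pb.primalValue μ z := by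
    simp [proxAL, primalValue, hb.2]
  rwa [h2] at h1

theorem le_neg_dualValue_add {flow : ℝ} (hflow : ∀ x ∈ pb.feasible, flow ≤ pb.f x) (y : Vec m)
    (z : Vec n) : flow ≤ -pb.dualValue ρ μ y z + 2 * pb.primalValue μ z := by
  linarith [le_primalValue h hμ hμ0 hflow z, dualValue_le_primalValue h hμ hμ0 hρ y z]

theorem continuous_potential : Continuous (pb.potential ρ μ) := by
  have h1 := continuous_primalValue h hμ hμ0
  have h2 := h.differentiable.continuous
  have h3 : Continuous fun q : Vec n × Vec m × Vec n => pb.xStar ρ μ q.2.1 q.2.2 :=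
    (continuous_xStar h hμ hμ0 hρ).comp continuous_snd
  unfold potential dualValue proxAL
  fun_prop

theorem continuous_residual : Continuous (pb.residual ρ μ) := by
  have h3 : Continuous fun q : Vec n × Vec m × Vec n => pb.xStar ρ μ q.2.1 q.2.2 :=
    (continuous_xStar h hμ hμ0 hρ).comp continuous_snd
  unfold residual
  fun_prop

/-- The change of `-d + 2P` in one iteration. Testing the minimum that defines `d(y, z)` with the
minimizer of the next iteration, and the one that defines `P` at the next iteration with the
present minimizer, makes second derivatives of `d` and `P` unnecessary. -/
theorem dual_primal_descent {σbar η β : ℝ} (hσ : pb.IsErrorBoundConst ρ μ σbar) (hη : 0 ≤ η)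
    (hβ : 0 ≤ β) (x : Vec n) (y : Vec m) (z : Vec n) {e r w q D : ℝ}
    (he : ‖x - pb.xStar ρ μ y z‖ = e) (hr : ‖pb.A (pb.xStar ρ μ y z) - pb.b‖ = r)
    (hw : ‖x - z‖ = w) (hq : ‖pb.A x - pb.b‖ = q)
    (hD : ‖pb.xStar ρ μ (pb.dualStep η x y) (z + β • (x - z)) - pb.xStar ρ μ y z‖ ≤ D) :
    -pb.dualValue ρ μ (pb.dualStep η x y) (z + β • (x - z)) +
        2 * pb.primalValue μ (z + β • (x - z)) ≤
      -pb.dualValue ρ μ y z + 2 * pb.primalValue μ z +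
      (-(η * r ^ 2) + η * ‖pb.A‖ * e * r + η * ‖pb.A‖ * q * D - μ * β * w ^ 2 + μ * β * w * e +
        2 * μ * β * σbar * w * r + μ * β * w * D + μ * β ^ 2 / 2 * w ^ 2) := by
  set y' := pb.dualStep η x y with hy'
  set z' := z + β • (x - z) with hz'
  set xs := pb.xStar ρ μ y z with hxs
  set xs' := pb.xStar ρ μ y' z' with hxs'
  set xb := pb.xBarStar μ z with hxb
  have h1 : pb.dualValue ρ μ y z ≤ pb.proxAL ρ μ xs' y z :=
    (xStar_spec h hμ hμ0 hρ y z).2 _ (xStar_spec h hμ hμ0 hρ y' z').1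
  have h2 : pb.primalValue μ z' ≤ pb.f xb + μ / 2 * ‖xb - z'‖ ^ 2 :=
    (xBarStar_spec h hμ hμ0 z').2 _ (xBarStar_spec h hμ hμ0 z).1
  have hexp : ∀ u : Vec n, ‖u - z'‖ ^ 2 =
      ‖u - z‖ ^ 2 - 2 * (β * inner ℝ (u - z) (x - z)) + β ^ 2 * w ^ 2 := by
    intro u
    rw [hz', ← sub_sub, norm_sub_sq_real, inner_smul_right, norm_smul, mul_pow, hw,
      Real.norm_eq_abs, sq_abs]
  have h3 : pb.proxAL ρ μ xs' y z - pb.dualValue ρ μ y' z' =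
      -(η * inner ℝ (pb.A xs' - pb.b) (pb.A x - pb.b)) +
        μ / 2 * (‖xs' - z‖ ^ 2 - ‖xs' - z'‖ ^ 2) := by
    have e1 : inner ℝ (pb.A xs' - pb.b) y' =
        inner ℝ (pb.A xs' - pb.b) y + η * inner ℝ (pb.A xs' - pb.b) (pb.A x - pb.b) := by
      rw [hy', dualStep, inner_add_right, inner_smul_right]
    have e2 : pb.dualValue ρ μ y' z' = pb.proxAL ρ μ xs' y' z' := rfl
    rw [e2, proxAL, proxAL, e1]
    ring
  have h4 : pb.primalValue μ z = pb.f xb + μ / 2 * ‖xb - z‖ ^ 2 := rfl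
  have h5 : inner ℝ (pb.A xs' - pb.b) (pb.A x - pb.b) =
      r ^ 2 + inner ℝ (pb.A xs - pb.b) (pb.A (x - xs)) +
        inner ℝ (pb.A (xs' - xs)) (pb.A x - pb.b) := by
    have e1 : pb.A xs' - pb.b = (pb.A xs - pb.b) + pb.A (xs' - xs) := by
      rw [map_sub]; abel
    have e2 : pb.A x - pb.b = (pb.A xs - pb.b) + pb.A (x - xs) := by
      rw [map_sub]; abel
    rw [e1, inner_add_left]
    congr 1
    rw [e2, inner_add_right, real_inner_self_eq_norm_sq, hr]
  have h6 : inner ℝ (xs' - z) (x - z) - 2 * inner ℝ (xb - z) (x - z) =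
      -w ^ 2 + inner ℝ (x - xs) (x - z) + 2 * inner ℝ (xs - xb) (x - z) +
        inner ℝ (xs' - xs) (x - z) := by
    have e1 : xs' - z = (x - z) - (x - xs) + (xs' - xs) := by abel
    have e2 : xb - z = (x - z) - (x - xs) - (xs - xb) := by abel
    rw [e1, e2]
    simp only [inner_add_left, inner_sub_left]
    rw [← hw, ← real_inner_self_eq_norm_sq]
    simp only [inner_sub_left, inner_sub_right]
    ring
  -- Cauchy-Schwarz for the cross terms
  have hr0 : 0 ≤ r := hr ▸ norm_nonneg _
  have hw0 : 0 ≤ w := hw ▸ norm_nonneg _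
  have hq0 : 0 ≤ q := hq ▸ norm_nonneg _
  have b1 : -(r * (‖pb.A‖ * e)) ≤ inner ℝ (pb.A xs - pb.b) (pb.A (x - xs)) := by
    refine le_trans (neg_le_neg ?_) (abs_le.1 (abs_real_inner_le_norm _ _)).1
    rw [hr, ← he]
    exact mul_le_mul_of_nonneg_left (pb.A.le_opNorm _) hr0
  have b2 : -(‖pb.A‖ * D * q) ≤ inner ℝ (pb.A (xs' - xs)) (pb.A x - pb.b) := by
    refine le_trans (neg_le_neg ?_) (abs_le.1 (abs_real_inner_le_norm _ _)).1
    rw [hq]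
    exact mul_le_mul_of_nonneg_right ((pb.A.le_opNorm _).trans
      (mul_le_mul_of_nonneg_left hD (norm_nonneg _))) hq0
  have b3 : inner ℝ (x - xs) (x - z) ≤ e * w := by
    have := real_inner_le_norm (x - xs) (x - z)
    rwa [he, hw] at this
  have b4 : inner ℝ (xs - xb) (x - z) ≤ σbar * r * w := by
    refine (real_inner_le_norm _ _).trans ?_
    rw [hw, ← hr]
    exact mul_le_mul_of_nonneg_right (hσ y z) hw0
  have b5 : inner ℝ (xs' - xs) (x - z) ≤ D * w := by
    refine (real_inner_le_norm _ _).trans ?_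
    rw [hw]
    exact mul_le_mul_of_nonneg_right hD hw0
  have hμβ : 0 ≤ μ * β := by positivity
  have m1 := mul_le_mul_of_nonneg_left b1 hη
  have m2 := mul_le_mul_of_nonneg_left b2 hη
  have m3 := mul_le_mul_of_nonneg_left (add_le_add (add_le_add b3
    (mul_le_mul_of_nonneg_left b4 zero_le_two)) b5) hμβ
  have m4 := congrArg (fun t => μ * β * t) h6
  have m5 := congrArg (fun t => η * t) h5
  have x1 := hexp xs'
  have x2 := hexp xb
  rw [x1] at h3
  rw [x2] at h2
  linarith

/-- A projected gradient step with an error `ζ` in the gradient, compared with the minimizer. -/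
theorem norm_projOn_step_sub_le {τ : ℝ} (hτ : 0 ≤ τ) (x : Vec n) (y : Vec m) (z ζ : Vec n) :
    ‖projOn pb.X (x - τ • (pb.proxGrad ρ μ y z x + ζ)) - pb.xStar ρ μ y z‖ ≤
      ‖(x - pb.xStar ρ μ y z -
        τ • (pb.proxGrad ρ μ y z x - pb.proxGrad ρ μ y z (pb.xStar ρ μ y z))) - τ • ζ‖ := by
  have h1 := (xStar_isVISol h hμ hμ0 hρ y z).projOn_eq pb.isClosed_X pb.convex_X hτ
  conv_lhs => rw [← h1]
  refine (norm_projOn_sub_le pb.isClosed_X pb.convex_X h.X_nonempty _ _).trans (le_of_eq ?_)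
  congr 1
  simp only [smul_sub, smul_add]
  abel

theorem gradient_step_contraction {τ lam : ℝ} (hτ : 0 ≤ τ) (hμ2 : 2 ≤ μ)
    (hlam : Lf + ρ * ‖pb.A‖ ^ 2 + μ = lam) (hτlam : 6 * (τ * lam ^ 2) ≤ 1)
    (x : Vec n) (y : Vec m) (z : Vec n) (u : Vec n) :
    ‖x - u - τ • (pb.proxGrad ρ μ y z x - pb.proxGrad ρ μ y z u)‖ ^ 2 ≤
      (1 - 17 / 12 * (τ * μ)) * ‖x - u‖ ^ 2 := by
  have h1 := h.proxGrad_stronglyMonotone hμ hρ y z x u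
  have h2 := proxGrad_lipschitz h hμ0.le hρ y z x u
  rw [hlam] at h2
  have h3 : ‖pb.proxGrad ρ μ y z x - pb.proxGrad ρ μ y z u‖ ^ 2 ≤ (lam * ‖x - u‖) ^ 2 := by
    gcongr
  rw [norm_sub_sq_real, inner_smul_right, norm_smul, Real.norm_of_nonneg hτ, mul_pow,
    real_inner_comm]
  have h4 := mul_le_mul_of_nonneg_left h1 hτ
  have h5 := mul_le_mul_of_nonneg_left h3 (sq_nonneg τ)
  have h6 : τ ^ 2 * (lam * ‖x - u‖) ^ 2 ≤ τ * μ / 12 * ‖x - u‖ ^ 2 := by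
    have e1 := mul_le_mul_of_nonneg_right hτlam (show 0 ≤ τ * ‖x - u‖ ^ 2 by positivity)
    have e2 := mul_le_mul_of_nonneg_right hμ2 (show 0 ≤ τ * ‖x - u‖ ^ 2 by positivity)
    linarith
  linarith

end

end LinConProblem

/-! ### Expected decrease of the potential -/

theorem norm_add_sq_le_young {V : Type*} [NormedAddCommGroup V] {θ : ℝ} (hθ : 0 < θ) (u v : V) :
    ‖u + v‖ ^ 2 ≤ (1 + θ) * ‖u‖ ^ 2 + (1 + 1 / θ) * ‖v‖ ^ 2 := by
  have h1 : ‖u + v‖ ^ 2 ≤ (‖u‖ + ‖v‖) ^ 2 := by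
    gcongr
    exact norm_add_le u v
  have h2 : (1 + θ) * ‖u‖ ^ 2 + (1 + 1 / θ) * ‖v‖ ^ 2 - (‖u‖ + ‖v‖) ^ 2 =
      (θ * ‖u‖ - ‖v‖) ^ 2 / θ := by
    field_simp
    ring
  have h3 : 0 ≤ (θ * ‖u‖ - ‖v‖) ^ 2 / θ := by positivity
  linarith

section Noise

variable {S V : Type*} [MeasurableSpace S] [NormedAddCommGroup V] [InnerProductSpace ℝ V]
  [CompleteSpace V] {Q : Measure S} [IsProbabilityMeasure Q] {ζ : S → V}

theorem integral_norm_sub_smul_sq (hint : Integrable ζ Q) (hmean : ∫ s, ζ s ∂Q = 0)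
    (hsq : Integrable (fun s => ‖ζ s‖ ^ 2) Q) (c : V) (τ : ℝ) :
    Integrable (fun s => ‖c - τ • ζ s‖ ^ 2) Q ∧
      ∫ s, ‖c - τ • ζ s‖ ^ 2 ∂Q = ‖c‖ ^ 2 + τ ^ 2 * ∫ s, ‖ζ s‖ ^ 2 ∂Q := by
  have h1 : ∀ s, ‖c - τ • ζ s‖ ^ 2 =
      ‖c‖ ^ 2 - 2 * τ * inner ℝ c (ζ s) + τ ^ 2 * ‖ζ s‖ ^ 2 := by
    intro s
    rw [norm_sub_sq_real, inner_smul_right, norm_smul, mul_pow, Real.norm_eq_abs, sq_abs]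
    ring
  have i1 : Integrable (fun s => inner ℝ c (ζ s)) Q := hint.const_inner c
  have i2 : Integrable (fun s => ‖c‖ ^ 2 - 2 * τ * inner ℝ c (ζ s)) Q :=
    (integrable_const _).sub (i1.const_mul _)
  simp only [h1]
  refine ⟨i2.add (hsq.const_mul _), ?_⟩
  rw [integral_add i2 (hsq.const_mul _), integral_sub (integrable_const _) (i1.const_mul _),
    integral_const_mul, integral_const_mul, integral_inner hint, hmean]
  simp

end Noise

namespace LinConProblem

variable {n m p : ℕ} {pb : LinConProblem n m p} {Lf : ℝ}

theorem stochGrad_eq {S : Type*} (ρ μ : ℝ) (F : Vec n → S → Vec n) (x : Vec n) (y : Vec m)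
    (z : Vec n) (s : S) : pb.stochGrad ρ μ F x y z s =
      pb.proxGrad ρ μ y z x + (F x s - gradient pb.f x) := by
  simp only [stochGrad, proxGrad]; abel

variable {S : Type*} [MeasurableSpace S]
  {Q : Measure S} {F : Vec n → S → Vec n} {σ : ℝ}

variable [IsProbabilityMeasure Q]

theorem _root_.IsStochasticOracle.integral_noise {f : Vec n → ℝ}
    (hF : IsStochasticOracle f σ Q F) (x c : Vec n) (τ : ℝ) :
    Integrable (fun s => ‖c - τ • (F x s - gradient f x)‖ ^ 2) Q ∧
      ∫ s, ‖c - τ • (F x s - gradient f x)‖ ^ 2 ∂Q ≤ ‖c‖ ^ 2 + τ ^ 2 * σ ^ 2 := by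
  obtain ⟨h1, h2⟩ := integral_norm_sub_smul_sq ((hF.integrable x).sub (integrable_const _))
    (by
      have := integral_sub (hF.integrable x) (integrable_const (μ := Q) (gradient f x))
      simpa [hF.unbiased] using this) (hF.integrable_sq x) c τ
  refine ⟨h1, ?_⟩
  simp only [Pi.sub_apply] at h2
  rw [h2]
  have := mul_le_mul_of_nonneg_left (hF.variance_le x) (sq_nonneg τ)
  linarith

/-- The expected decrease of the potential in one iteration, for a fixed present state `q` and one
fresh sample. -/
theorem lintegral_potential_step {par : AlgParams} {lam σbar flow c : ℝ}
    (h : pb.Regular Lf) (hμ : 4 * Lf ≤ par.μ) (hρ : 0 ≤ par.ρ)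
    (hlam : Lf + par.ρ * ‖pb.A‖ ^ 2 + par.μ = lam)
    (hs : StepSizes par.μ lam ‖pb.A‖ σbar par.τ par.η par.β)
    (hσ : pb.IsErrorBoundConst par.ρ par.μ σbar) (hF : IsStochasticOracle pb.f σ Q F)
    (hflow : ∀ x ∈ pb.feasible, flow ≤ pb.f x) (hc0 : 0 ≤ c) (hc1 : c ≤ par.τ * par.μ / 2)
    (hc2 : c ≤ par.η / 2) (hc3 : c ≤ par.μ * par.β / 4) (q : Vec n × Vec m × Vec n) :
    ∫⁻ s, ENNReal.ofReal (pb.potential par.ρ par.μ (pb.stepMap par F q s) - flow) ∂Q +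
        ENNReal.ofReal (c * pb.residual par.ρ par.μ q) ≤
      ENNReal.ofReal (pb.potential par.ρ par.μ q - flow) +
        ENNReal.ofReal (2 * (par.τ ^ 2 * σ ^ 2)) := by
  obtain ⟨x, y, z⟩ := q
  obtain ⟨ρ, μ, τ, η, β⟩ := par
  dsimp only at *
  have hμ0 : 0 < μ := by linarith [hs.two_le_μ]
  have hτ := hs.τ_pos
  set y' := pb.dualStep η x y with hy'
  set z' := z + β • (x - z) with hz'
  set xs := pb.xStar ρ μ y z with hxs
  set xt := pb.xStar ρ μ y' z with hxt
  set xs' := pb.xStar ρ μ y' z' with hxs'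
  set d₁ := ‖xs - xt‖ with hd₁
  set d₂ := ‖xt - xs'‖ with hd₂
  set u := τ * μ with hu
  have hu0 : 0 < u := mul_pos hτ hμ0
  have hu1 : 12 * u ≤ 1 := hs.τμ_le
  have hd₁le : 3 * μ * d₁ ≤ 4 * (‖pb.A‖ * η * ‖pb.A x - pb.b‖) := by
    have := norm_xStar_sub_le h hμ hμ0 hρ y y' z z
    have e : ‖y - y'‖ = η * ‖pb.A x - pb.b‖ := by
      rw [hy', dualStep, sub_add_cancel_left, norm_neg, norm_smul,
        Real.norm_of_nonneg hs.η_pos.le]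
    rw [e, sub_self, norm_zero, mul_zero, add_zero] at this
    linarith
  have hd₂le : 3 * d₂ ≤ 4 * (β * ‖x - z‖) := by
    have := norm_xStar_sub_le h hμ hμ0 hρ y' y' z z'
    have e : ‖z - z'‖ = β * ‖x - z‖ := by
      rw [hz', sub_add_cancel_left, norm_neg, norm_smul, Real.norm_of_nonneg hs.β_pos.le]
    rw [e, sub_self, norm_zero, mul_zero, zero_add] at this
    have : μ * (3 / 4 * d₂) ≤ μ * (β * ‖x - z‖) := by linarith
    linarith [le_of_mul_le_mul_left this hμ0]
  have hD : ‖xs' - xs‖ ≤ d₁ + d₂ := by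
    rw [norm_sub_rev]
    exact norm_sub_le_norm_sub_add_norm_sub xs xt xs'
  have hq : ‖pb.A x - pb.b‖ ≤ ‖pb.A xs - pb.b‖ + ‖pb.A‖ * ‖x - xs‖ := by
    have e1 : pb.A x - pb.b = (pb.A xs - pb.b) + pb.A (x - xs) := by
      rw [map_sub]; abel
    rw [e1]
    exact (norm_add_le _ _).trans (add_le_add le_rfl (pb.A.le_opNorm _))
  have hdesc := dual_primal_descent h hμ hμ0 hρ hσ hs.η_pos.le hs.β_pos.le x y z rfl rfl rfl rfl hD
  have hnum := hs.descent_le (e := ‖x - xs‖) (norm_nonneg (x - z))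
    (norm_nonneg (pb.A x - pb.b)) (norm_nonneg (xs - xt)) (norm_nonneg (xt - xs')) hq hd₁le hd₂le
  -- the noise enters through the square of `c₀ - τ ζ`, with `c₀` known before the sample is drawn
  set c₀ := x - xt - τ • (pb.proxGrad ρ μ y' z x - pb.proxGrad ρ μ y' z xt) with hc₀
  obtain ⟨hint, hle⟩ := hF.integral_noise x c₀ τ
  have hcontr : ‖c₀‖ ^ 2 ≤ (1 - 17 / 12 * u) * ‖x - xt‖ ^ 2 :=
    gradient_step_contraction h hμ hμ0 hρ hτ.le hs.two_le_μ hlam hs.τ_le x y' z xt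
  have hθ : 1 / (u / 4) = 4 / u := by rw [one_div_div]
  have hxxt : ‖x - xt‖ ^ 2 ≤ (1 + u / 4) * ‖x - xs‖ ^ 2 + (1 + 4 / u) * d₁ ^ 2 := by
    have := norm_add_sq_le_young (show 0 < u / 4 by positivity) (x - xs) (xs - xt)
    rwa [sub_add_sub_cancel, hθ] at this
  have htrack := hs.tracking_le (e := ‖x - xs‖) (d₁ := d₁) (d₂ := d₂)
    (v := τ ^ 2 * σ ^ 2) (by positivity)
  set K₀ := (1 + 4 / u) * d₂ ^ 2 + (-pb.dualValue ρ μ y' z' + 2 * pb.primalValue μ z' - flow)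
    with hK₀
  have hK₀0 : 0 ≤ K₀ := by
    have := le_neg_dualValue_add h hμ hμ0 hρ hflow y' z'
    have : 0 ≤ (1 + 4 / u) * d₂ ^ 2 := by positivity
    rw [hK₀]
    linarith
  have hpt : ∀ s, pb.potential ρ μ (pb.stepMap ⟨ρ, μ, τ, η, β⟩ F (x, y, z) s) - flow ≤
      (1 + u / 4) * ‖c₀ - τ • (F x s - gradient pb.f x)‖ ^ 2 + K₀ := by
    intro s
    have h1 := norm_projOn_step_sub_le h hμ hμ0 hρ hτ.le x y' z (F x s - gradient pb.f x)
    rw [← stochGrad_eq] at h1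
    set x' := projOn pb.X (x - τ • pb.stochGrad ρ μ F x y' z s) with hx'
    have h2 := norm_add_sq_le_young (show 0 < u / 4 by positivity) (x' - xt) (xt - xs')
    rw [sub_add_sub_cancel, hθ] at h2
    have h3 : ‖x' - xt‖ ^ 2 ≤ ‖c₀ - τ • (F x s - gradient pb.f x)‖ ^ 2 := by gcongr
    have h4 := mul_le_mul_of_nonneg_left h3 (show 0 ≤ 1 + u / 4 by positivity)
    change ‖x' - xs'‖ ^ 2 - pb.dualValue ρ μ y' z' + 2 * pb.primalValue μ z' - flow ≤ _
    rw [hK₀]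
    linarith
  have hres0 : 0 ≤ pb.residual ρ μ (x, y, z) := by
    unfold residual; positivity
  have hint' : Integrable (fun s => (1 + u / 4) * ‖c₀ - τ • (F x s - gradient pb.f x)‖ ^ 2 + K₀)
      Q := (hint.const_mul _).add (integrable_const _)
  have hlin : ∫⁻ s, ENNReal.ofReal
      (pb.potential ρ μ (pb.stepMap ⟨ρ, μ, τ, η, β⟩ F (x, y, z) s) - flow) ∂Q ≤
      ENNReal.ofReal ((1 + u / 4) * (‖c₀‖ ^ 2 + τ ^ 2 * σ ^ 2) + K₀) := by
    refine (lintegral_mono fun s => ENNReal.ofReal_le_ofReal (hpt s)).trans ?_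
    rw [← ofReal_integral_eq_lintegral_ofReal hint'
      (Filter.Eventually.of_forall fun s => by positivity)]
    refine ENNReal.ofReal_le_ofReal ?_
    rw [integral_add (hint.const_mul _) (integrable_const _), integral_const_mul]
    simp only [integral_const, probReal_univ, one_smul]
    have := mul_le_mul_of_nonneg_left hle (show 0 ≤ 1 + u / 4 by positivity)
    linarith
  refine (add_le_add hlin le_rfl).trans ?_
  have hpot0 : 0 ≤ pb.potential ρ μ (x, y, z) - flow := by
    have := le_neg_dualValue_add h hμ hμ0 hρ hflow y z
    have : 0 ≤ ‖x - xs‖ ^ 2 := by positivity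
    simp only [potential]
    linarith
  rw [← ENNReal.ofReal_add (by positivity) (by positivity),
    ← ENNReal.ofReal_add hpot0 (by positivity)]
  refine ENNReal.ofReal_le_ofReal ?_
  have e1 : (1 + u / 4) * (‖c₀‖ ^ 2 + τ ^ 2 * σ ^ 2) ≤ (1 + u / 4) * ((1 - 17 / 12 * u) *
        ((1 + u / 4) * ‖x - xs‖ ^ 2 + (1 + 4 / u) * d₁ ^ 2) + τ ^ 2 * σ ^ 2) := by
    refine mul_le_mul_of_nonneg_left ?_ (by positivity)
    have := mul_le_mul_of_nonneg_left hxxt (show 0 ≤ 1 - 17 / 12 * u by linarith)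
    linarith
  have e2 : c * pb.residual ρ μ (x, y, z) ≤ u / 2 * ‖x - xs‖ ^ 2 +
      η / 2 * ‖pb.A xs - pb.b‖ ^ 2 + μ * β / 4 * ‖x - z‖ ^ 2 := by
    have a1 := mul_le_mul_of_nonneg_right hc1 (sq_nonneg ‖x - xs‖)
    have a2 := mul_le_mul_of_nonneg_right hc2 (sq_nonneg ‖pb.A xs - pb.b‖)
    have a3 := mul_le_mul_of_nonneg_right hc3 (sq_nonneg ‖x - z‖)
    simp only [residual]
    rw [mul_add, mul_add]
    linarith
  have e3 : pb.potential ρ μ (x, y, z) =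
      ‖x - xs‖ ^ 2 - pb.dualValue ρ μ y z + 2 * pb.primalValue μ z := rfl
  rw [e3, hK₀]
  linarith

end LinConProblem

/-! ### Fresh samples and the random index -/

theorem memLp_two_of_lintegral_le {Ω : Type*} [MeasurableSpace Ω] {P : Measure Ω}
    {V : Type*} [NormedAddCommGroup V] [MeasurableSpace V]
    [BorelSpace V] [SecondCountableTopology V] {v : Ω → V} (hv : Measurable v) {δ : ℝ}
    (hδ : 0 ≤ δ) (h : ∫⁻ ω, ENNReal.ofReal (‖v ω‖ ^ 2) ∂P ≤ ENNReal.ofReal δ) :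
    MemLp v 2 P ∧ ∫ ω, ‖v ω‖ ^ 2 ∂P ≤ δ := by
  have hm : Measurable fun ω => ‖v ω‖ ^ 2 := hv.norm.pow_const 2
  have h0 : 0 ≤ᵐ[P] fun ω => ‖v ω‖ ^ 2 := Filter.Eventually.of_forall fun ω => by positivity
  refine ⟨(memLp_two_iff_integrable_sq_norm hv.aestronglyMeasurable).2
    ⟨hm.aestronglyMeasurable, (hasFiniteIntegral_iff_ofReal h0).2
      (h.trans_lt ENNReal.ofReal_lt_top)⟩, ?_⟩
  rw [integral_eq_lintegral_of_nonneg_ae h0 hm.aestronglyMeasurable]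
  exact ENNReal.toReal_le_of_le_ofReal hδ h

section Sampling

variable {S Ω α : Type*} [MeasurableSpace S] [MeasurableSpace Ω] [MeasurableSpace α]
  {P : Measure Ω} {Q : Measure S} {ξ : ℕ → Ω → S} {T : ℕ} {tstar : Ω → ℕ}

/-- A function of a stream that depends only on its first `k` entries. -/
def DependsOnFirst (k : ℕ) (R : (ℕ → S) → α) : Prop :=
  ∀ u u' : ℕ → S, (∀ i < k, u i = u' i) → R u = R u'

theorem IsSampling.measurable_stream (hs : IsSampling P Q ξ T tstar) :
    Measurable fun ω k => ξ k ω :=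
  measurable_pi_lambda _ hs.measurable_sample

theorem IsSampling.indepFun_sample [IsProbabilityMeasure Q] (hs : IsSampling P Q ξ T tstar)
    {k : ℕ} {R : (ℕ → S) → α} (hR : Measurable R) (hdep : DependsOnFirst k R) :
    IndepFun (fun ω => R fun i => ξ i ω) (ξ k) P := by
  classical
  obtain ⟨s₀⟩ := nonempty_of_isProbabilityMeasure Q
  have h1 := hs.indep.indepFun_finset (Finset.range k) {k} (by simp) hs.measurable_sample
  let ext : (Finset.range k → S) → ℕ → S := fun v i =>
    if h : i ∈ Finset.range k then v ⟨i, h⟩ else s₀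
  have hext : Measurable ext := by
    refine measurable_pi_lambda _ fun i => ?_
    by_cases h : i ∈ Finset.range k
    · simp only [ext, h, dite_true]
      exact measurable_pi_apply _
    · simp only [ext, h, dite_false]
      exact measurable_const
  have h2 := h1.comp (hR.comp hext)
    (measurable_pi_apply (⟨k, Finset.mem_singleton_self k⟩ : ({k} : Finset ℕ)))
  have h3 : (fun ω => R fun i => ξ i ω) =
      (R ∘ ext) ∘ fun ω (i : Finset.range k) => ξ i ω := by
    funext ω
    refine hdep _ _ fun i hi => ?_
    simp [ext, hi]
  rw [h3]
  exact h2

/-- Integrating out a sample that has not been used yet. -/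
theorem IsSampling.lintegral_fresh [IsProbabilityMeasure P] [IsProbabilityMeasure Q]
    (hs : IsSampling P Q ξ T tstar) {k : ℕ} {R : (ℕ → S) → α}
    (hR : Measurable R) (hdep : DependsOnFirst k R) {g : α → S → ENNReal}
    (hg : Measurable (Function.uncurry g)) :
    ∫⁻ ω, g (R fun i => ξ i ω) (ξ k ω) ∂P = ∫⁻ ω, ∫⁻ s, g (R fun i => ξ i ω) s ∂Q ∂P := by
  have hRξ : Measurable fun ω => R fun i => ξ i ω := hR.comp hs.measurable_stream
  have h1 := (indepFun_iff_map_prod_eq_prod_map_map hRξ.aemeasurable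
    (hs.measurable_sample k).aemeasurable).1 (hs.indepFun_sample hR hdep)
  have h2 : ∫⁻ ω, g (R fun i => ξ i ω) (ξ k ω) ∂P =
      ∫⁻ q, Function.uncurry g q ∂(P.map fun ω => (R fun i => ξ i ω, ξ k ω)) := by
    rw [lintegral_map hg (hRξ.prodMk (hs.measurable_sample k))]
    rfl
  rw [h2, h1, hs.law, lintegral_prod _ hg.aemeasurable,
    lintegral_map hg.lintegral_prod_right' hRξ]
  rfl

/-- The expectation at the uniformly distributed index is the average of the expectations. -/
theorem IsSampling.lintegral_tstar [IsProbabilityMeasure P] (hs : IsSampling P Q ξ T tstar)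
    (hT : 0 < T)
    {g : ℕ → (ℕ → S) → ENNReal} (hg : ∀ t, Measurable (g t)) :
    ∫⁻ ω, g (tstar ω) (fun k => ξ k ω) ∂P =
      (T : ENNReal)⁻¹ * ∑ t ∈ Finset.Icc 1 T, ∫⁻ ω, g t (fun k => ξ k ω) ∂P := by
  have hmem : ∀ᵐ ω ∂P, tstar ω ∈ Finset.Icc 1 T := by
    have hunion : tstar ⁻¹' (Finset.Icc 1 T : Finset ℕ) =
        ⋃ t ∈ Finset.Icc 1 T, tstar ⁻¹' {t} := by
      ext ω; simp
    have hmeas : ∀ t, MeasurableSet (tstar ⁻¹' {t}) := fun t =>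
      hs.measurable_tstar (measurableSet_singleton t)
    have h1 : P (tstar ⁻¹' (Finset.Icc 1 T : Finset ℕ)) = 1 := by
      rw [hunion, measure_biUnion_finset _ fun t _ => hmeas t, Finset.sum_congr rfl hs.uniform]
      · simp only [Finset.sum_const, Nat.card_Icc, add_tsub_cancel_right, nsmul_eq_mul]
        exact ENNReal.mul_inv_cancel (by exact_mod_cast hT.ne') (ENNReal.natCast_ne_top T)
      · intro i _ j _ hij
        exact Disjoint.preimage _ (by simpa using hij)
    exact (prob_compl_eq_zero_iff (hs.measurable_tstar (Finset.measurableSet _))).2 h1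
  have hind : ∀ t, Measurable fun n : ℕ => if n = t then (1 : ENNReal) else 0 :=
    fun t => measurable_of_countable _
  calc ∫⁻ ω, g (tstar ω) (fun k => ξ k ω) ∂P
      = ∫⁻ ω, ∑ t ∈ Finset.Icc 1 T,
          (if tstar ω = t then (1 : ENNReal) else 0) * g t (fun k => ξ k ω) ∂P := by
        refine lintegral_congr_ae ?_
        filter_upwards [hmem] with ω hω
        simp only [ite_mul, one_mul, zero_mul, Finset.sum_ite_eq, hω, if_true]
    _ = ∑ t ∈ Finset.Icc 1 T, ∫⁻ ω,
          (if tstar ω = t then (1 : ENNReal) else 0) * g t (fun k => ξ k ω) ∂P :=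
        lintegral_finsetSum _ fun t _ => ((hind t).comp hs.measurable_tstar).mul
          ((hg t).comp hs.measurable_stream)
    _ = ∑ t ∈ Finset.Icc 1 T, (T : ENNReal)⁻¹ * ∫⁻ ω, g t (fun k => ξ k ω) ∂P := by
        refine Finset.sum_congr rfl fun t ht => ?_
        have h1 := lintegral_mul_eq_lintegral_mul_lintegral_of_indepFun
          ((hind t).comp hs.measurable_tstar) ((hg t).comp hs.measurable_stream)
          (hs.indep_tstar.comp (hind t) (hg t))
        have h2 : ∫⁻ ω, (if tstar ω = t then (1 : ENNReal) else 0) ∂P = (T : ENNReal)⁻¹ := by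
          rw [← hs.uniform t ht, ← lintegral_indicator_one
            (hs.measurable_tstar (measurableSet_singleton t))]
          refine lintegral_congr fun ω => ?_
          simp [Set.indicator]
        rw [← h2]
        exact h1
    _ = _ := by rw [Finset.mul_sum]

end Sampling

/-! ### The expected residual along the run -/

namespace LinConProblem

variable {n m p : ℕ} {pb : LinConProblem n m p} {Lf : ℝ} {S Ω : Type*} [MeasurableSpace S]
  [MeasurableSpace Ω] {P : Measure Ω} {Q : Measure S} {F : Vec n → S → Vec n} {σ : ℝ}
  {ξ : ℕ → Ω → S} {T : ℕ} {tstar : Ω → ℕ}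

/-- The state `(x_t, y_t, z_t)` as a function of the stream of samples. -/
def runMap {S : Type*} (pb : LinConProblem n m p) (par : AlgParams) (F : Vec n → S → Vec n)
    (x₀ : Vec n) (y₀ : Vec m) : ℕ → (ℕ → S) → Vec n × Vec m × Vec n
  | 0, _ => (x₀, y₀, x₀)
  | t + 1, u => pb.stepMap par F (runMap pb par F x₀ y₀ t u) (u t)

theorem algRun_eq {S : Type*} (par : AlgParams) (F : Vec n → S → Vec n) (u : ℕ → S) (x₀ : Vec n)
    (y₀ : Vec m) (t : ℕ) :
    pb.algRun par F u x₀ y₀ t = ⟨(pb.runMap par F x₀ y₀ t u).1, (pb.runMap par F x₀ y₀ t u).2.1,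
      (pb.runMap par F x₀ y₀ t u).2.2, t⟩ := by
  induction t with
  | zero => rfl
  | succ t ih => rw [algRun, ih]; rfl

theorem runMap_dependsOnFirst {S : Type*} (par : AlgParams) (F : Vec n → S → Vec n) (x₀ : Vec n)
    (y₀ : Vec m) (t : ℕ) : DependsOnFirst t (pb.runMap par F x₀ y₀ t) := by
  induction t with
  | zero => exact fun _ _ _ => rfl
  | succ t ih =>
    intro u u' h
    rw [runMap, runMap, ih u u' fun i hi => h i (hi.trans t.lt_succ_self), h t t.lt_succ_self]

theorem measurable_stepMap (h : pb.Regular Lf) (par : AlgParams)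
    (hF : Measurable (Function.uncurry F)) : Measurable (Function.uncurry (pb.stepMap par F)) := by
  have hproj := (continuous_projOn pb.isClosed_X pb.convex_X h.X_nonempty).measurable
  have hFm : Measurable fun q : (Vec n × Vec m × Vec n) × S => F q.1.1 q.2 :=
    hF.comp (measurable_fst.fst.prodMk measurable_snd)
  have hy : Measurable fun q : (Vec n × Vec m × Vec n) × S => pb.dualStep par.η q.1.1 q.1.2.1 := by
    unfold dualStep
    fun_prop
  have hG : Measurable fun q : (Vec n × Vec m × Vec n) × S => pb.stochGrad par.ρ par.μ F q.1.1
      (pb.dualStep par.η q.1.1 q.1.2.1) q.1.2.2 q.2 := by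
    unfold stochGrad
    fun_prop
  have hx : Measurable fun q : (Vec n × Vec m × Vec n) × S => q.1.1 - par.τ •
      pb.stochGrad par.ρ par.μ F q.1.1 (pb.dualStep par.η q.1.1 q.1.2.1) q.1.2.2 q.2 :=
    measurable_fst.fst.sub (hG.const_smul par.τ)
  have hz : Measurable fun q : (Vec n × Vec m × Vec n) × S =>
      q.1.2.2 + par.β • (q.1.1 - q.1.2.2) := by fun_prop
  exact (hproj.comp hx).prodMk (hy.prodMk hz)

theorem measurable_runMap (h : pb.Regular Lf) (par : AlgParams)
    (hF : Measurable (Function.uncurry F)) (x₀ : Vec n) (y₀ : Vec m) (t : ℕ) :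
    Measurable (pb.runMap par F x₀ y₀ t) := by
  induction t with
  | zero => exact measurable_const
  | succ t ih =>
    have h1 : Measurable fun u : ℕ → S => (pb.runMap par F x₀ y₀ t u, u t) :=
      ih.prodMk (measurable_pi_apply t)
    have h2 : pb.runMap par F x₀ y₀ (t + 1) =
        Function.uncurry (pb.stepMap par F) ∘ fun u => (pb.runMap par F x₀ y₀ t u, u t) := by
      funext u
      rw [runMap, Function.comp_apply, Function.uncurry_apply_pair]
    rw [h2]
    exact (measurable_stepMap h par hF).comp h1

variable [IsProbabilityMeasure Q] [IsProbabilityMeasure P]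

/-- The telescoped decrease of the potential. -/
theorem sum_lintegral_residual_le {par : AlgParams} {lam σbar flow c : ℝ}
    (h : pb.Regular Lf) (hμ : 4 * Lf ≤ par.μ) (hρ : 0 ≤ par.ρ)
    (hlam : Lf + par.ρ * ‖pb.A‖ ^ 2 + par.μ = lam)
    (hst : StepSizes par.μ lam ‖pb.A‖ σbar par.τ par.η par.β)
    (hσ : pb.IsErrorBoundConst par.ρ par.μ σbar) (hF : IsStochasticOracle pb.f σ Q F)
    (hflow : ∀ x ∈ pb.feasible, flow ≤ pb.f x) (hc0 : 0 ≤ c) (hc1 : c ≤ par.τ * par.μ / 2)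
    (hc2 : c ≤ par.η / 2) (hc3 : c ≤ par.μ * par.β / 4) (hs : IsSampling P Q ξ T tstar)
    (x₀ : Vec n) (y₀ : Vec m) (k : ℕ) :
    ∫⁻ ω, ENNReal.ofReal (pb.potential par.ρ par.μ
        (pb.runMap par F x₀ y₀ k fun i => ξ i ω) - flow) ∂P +
      ∑ t ∈ Finset.range k, ∫⁻ ω, ENNReal.ofReal (c * pb.residual par.ρ par.μ
        (pb.runMap par F x₀ y₀ t fun i => ξ i ω)) ∂P ≤
    ENNReal.ofReal (pb.potential par.ρ par.μ (x₀, y₀, x₀) - flow) +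
      k * ENNReal.ofReal (2 * (par.τ ^ 2 * σ ^ 2)) := by
  have hμ0 : 0 < par.μ := by linarith [hst.two_le_μ]
  have hpot := (continuous_potential h hμ hμ0 hρ).measurable
  have hres := (continuous_residual h hμ hμ0 hρ).measurable
  induction k with
  | zero => simp [runMap]
  | succ k ih =>
    have hR := measurable_runMap h par hF.measurable x₀ y₀ k
    have hRξ : Measurable fun ω => pb.runMap par F x₀ y₀ k fun i => ξ i ω :=
      hR.comp hs.measurable_stream
    have hresm : Measurable fun ω => ENNReal.ofReal (c * pb.residual par.ρ par.μ
        (pb.runMap par F x₀ y₀ k fun i => ξ i ω)) :=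
      ((hres.comp hRξ).const_mul c).ennreal_ofReal
    have h1 : ∫⁻ ω, ENNReal.ofReal (pb.potential par.ρ par.μ
          (pb.runMap par F x₀ y₀ (k + 1) fun i => ξ i ω) - flow) ∂P =
        ∫⁻ ω, ∫⁻ s, ENNReal.ofReal (pb.potential par.ρ par.μ
          (pb.stepMap par F (pb.runMap par F x₀ y₀ k fun i => ξ i ω) s) - flow) ∂Q ∂P :=
      hs.lintegral_fresh (g := fun q s => ENNReal.ofReal (pb.potential par.ρ par.μ
          (pb.stepMap par F q s) - flow)) hR (runMap_dependsOnFirst par F x₀ y₀ k)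
        ((hpot.comp (measurable_stepMap h par hF.measurable)).sub_const flow).ennreal_ofReal
    have h2 : ∫⁻ ω, ∫⁻ s, ENNReal.ofReal (pb.potential par.ρ par.μ
          (pb.stepMap par F (pb.runMap par F x₀ y₀ k fun i => ξ i ω) s) - flow) ∂Q ∂P +
        ∫⁻ ω, ENNReal.ofReal (c * pb.residual par.ρ par.μ
          (pb.runMap par F x₀ y₀ k fun i => ξ i ω)) ∂P ≤
        ∫⁻ ω, ENNReal.ofReal (pb.potential par.ρ par.μ
          (pb.runMap par F x₀ y₀ k fun i => ξ i ω) - flow) ∂P +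
        ENNReal.ofReal (2 * (par.τ ^ 2 * σ ^ 2)) := by
      rw [← lintegral_add_right _ hresm]
      refine (lintegral_mono fun ω => lintegral_potential_step h hμ hρ hlam hst hσ hF hflow
        hc0 hc1 hc2 hc3 _).trans (le_of_eq ?_)
      rw [lintegral_add_right _ measurable_const]
      simp
    rw [h1, Finset.sum_range_succ, ← add_assoc, add_right_comm]
    refine (add_le_add h2 le_rfl).trans ?_
    rw [add_right_comm]
    refine (add_le_add ih le_rfl).trans (le_of_eq ?_)
    push_cast
    ring

/-- The mean square of the sum of `B` fresh noise vectors at the random point `x_t`. -/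
theorem lintegral_noise_sum_le (h : pb.Regular Lf) (hLf : 0 ≤ Lf) (par : AlgParams)
    (hF : IsStochasticOracle pb.f σ Q F) (hs : IsSampling P Q ξ T tstar) (x₀ : Vec n) (y₀ : Vec m)
    {t : ℕ} (ht : t ≤ T) (B : ℕ) :
    ∫⁻ ω, ENNReal.ofReal (‖∑ i ∈ Finset.range B,
      (F (pb.runMap par F x₀ y₀ t fun i => ξ i ω).1 (ξ (T + i) ω) -
        gradient pb.f (pb.runMap par F x₀ y₀ t fun i => ξ i ω).1)‖ ^ 2) ∂P ≤
      ENNReal.ofReal (B * σ ^ 2) := by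
  have hgrad := (h.continuous_gradient hLf).measurable
  have hnoise : Measurable fun q : Vec n × S => F q.1 q.2 - gradient pb.f q.1 :=
    hF.measurable.sub (hgrad.comp measurable_fst)
  induction B with
  | zero => simp
  | succ B ih =>
    -- the present point together with the partial sum is a state that has not used sample `T + B`
    let R : (ℕ → S) → Vec n × Vec n := fun u => ((pb.runMap par F x₀ y₀ t u).1,
      ∑ i ∈ Finset.range B, (F (pb.runMap par F x₀ y₀ t u).1 (u (T + i)) -
        gradient pb.f (pb.runMap par F x₀ y₀ t u).1))
    have hRm : Measurable R := by
      have h1 := (measurable_runMap h par hF.measurable x₀ y₀ t).fst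
      exact h1.prodMk (Finset.measurable_sum _ fun i _ =>
        hnoise.comp (h1.prodMk (measurable_pi_apply (T + i))))
    have hdep : DependsOnFirst (T + B) R := by
      intro u u' huu
      have h1 := runMap_dependsOnFirst (pb := pb) par F x₀ y₀ t u u' fun i hi => huu i (by omega)
      simp only [R, h1]
      congr 1
      refine Finset.sum_congr rfl fun i hi => ?_
      rw [huu (T + i) (by have := Finset.mem_range.1 hi; omega)]
    have hg : Measurable (Function.uncurry fun (q : Vec n × Vec n) (s : S) =>
        ENNReal.ofReal (‖q.2 - (-1 : ℝ) • (F q.1 s - gradient pb.f q.1)‖ ^ 2)) := by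
      have h1 : Measurable fun q : (Vec n × Vec n) × S => F q.1.1 q.2 - gradient pb.f q.1.1 :=
        hnoise.comp (measurable_fst.fst.prodMk measurable_snd)
      exact ((measurable_fst.snd.sub (h1.const_smul (-1 : ℝ))).norm.pow_const 2).ennreal_ofReal
    have h1 := hs.lintegral_fresh hRm hdep hg
    simp only [Finset.sum_range_succ]
    have h2 : ∀ q : Vec n × Vec n, ∫⁻ s, ENNReal.ofReal
        (‖q.2 - (-1 : ℝ) • (F q.1 s - gradient pb.f q.1)‖ ^ 2) ∂Q ≤
        ENNReal.ofReal (‖q.2‖ ^ 2) + ENNReal.ofReal (σ ^ 2) := by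
      intro q
      obtain ⟨hi, hle⟩ := hF.integral_noise q.1 q.2 (-1)
      rw [← ofReal_integral_eq_lintegral_ofReal hi
        (Filter.Eventually.of_forall fun s => by positivity),
        ← ENNReal.ofReal_add (by positivity) (by positivity)]
      exact ENNReal.ofReal_le_ofReal (by linarith)
    calc _ = ∫⁻ ω, ENNReal.ofReal (‖(R fun i => ξ i ω).2 - (-1 : ℝ) •
          (F (R fun i => ξ i ω).1 (ξ (T + B) ω) - gradient pb.f (R fun i => ξ i ω).1)‖ ^ 2) ∂P := by
          simp only [R, neg_one_smul, sub_neg_eq_add]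
      _ = _ := h1
      _ ≤ ∫⁻ ω, (ENNReal.ofReal (‖(R fun i => ξ i ω).2‖ ^ 2) + ENNReal.ofReal (σ ^ 2)) ∂P :=
          lintegral_mono fun ω => h2 _
      _ = ∫⁻ ω, ENNReal.ofReal (‖(R fun i => ξ i ω).2‖ ^ 2) ∂P + ENNReal.ofReal (σ ^ 2) := by
          rw [lintegral_add_right _ measurable_const]; simp
      _ ≤ ENNReal.ofReal (B * σ ^ 2) + ENNReal.ofReal (σ ^ 2) := add_le_add ih le_rfl
      _ = _ := by
          rw [← ENNReal.ofReal_add (by positivity) (by positivity)]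
          congr 1
          push_cast
          ring

end LinConProblem

/-! ### The post-processed point -/

namespace LinConProblem

open ContinuousLinearMap (adjoint)

variable {n m p : ℕ} {pb : LinConProblem n m p} {Lf ρ μ : ℝ}

/-- One projected step of size `τhat` from `x` along `∇_x K(x, y, z) + err`. -/
def outPoint (pb : LinConProblem n m p) (ρ μ τhat : ℝ) (x : Vec n) (y : Vec m) (z err : Vec n) :
    Vec n :=
  projOn pb.X (x - τhat • (pb.proxGrad ρ μ y z x + err))

/-- The element of `∇f(x̂) + Aᵀ y + N_X(x̂)` that the optimality condition of the projection
defining `x̂ = outPoint` provides. -/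
def outCertificate (pb : LinConProblem n m p) (ρ μ τhat : ℝ) (x : Vec n) (y : Vec m)
    (z err : Vec n) : Vec n :=
  τhat⁻¹ • (x - pb.outPoint ρ μ τhat x y z err) - (pb.proxGrad ρ μ y z x + err) +
    (gradient pb.f (pb.outPoint ρ μ τhat x y z err) + adjoint pb.A y)

theorem outCertificate_mem (h : pb.Regular Lf) {τhat : ℝ} (hτ : 0 < τhat) (x : Vec n) (y : Vec m)
    (z err : Vec n) : pb.outCertificate ρ μ τhat x y z err ∈
      pb.stationaritySet (pb.outPoint ρ μ τhat x y z err) y := by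
  have h1 := sub_projOn_mem_normalCone pb.isClosed_X pb.convex_X h.X_nonempty
    (x - τhat • (pb.proxGrad ρ μ y z x + err))
  refine ⟨h1.1, fun v hv => ?_⟩
  have h2 := h1.2 v hv
  have h3 : pb.outCertificate ρ μ τhat x y z err -
      (gradient pb.f (pb.outPoint ρ μ τhat x y z err) + adjoint pb.A y) =
      τhat⁻¹ • (x - τhat • (pb.proxGrad ρ μ y z x + err) -
        pb.outPoint ρ μ τhat x y z err) := by
    rw [outCertificate, add_sub_cancel_right, sub_right_comm x,
      smul_sub τhat⁻¹ (x - pb.outPoint ρ μ τhat x y z err), smul_smul,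
      inv_mul_cancel₀ hτ.ne', one_smul]
  rw [h3, real_inner_smul_left]
  exact mul_nonpos_of_nonneg_of_nonpos (inv_nonneg.2 hτ.le) h2

set_option maxHeartbeats 1000000 in
/-- Infeasibility and stationarity of the post-processed point are controlled by the residual of
the state and by the error of the minibatch gradient. -/
theorem exists_outPoint_bound (h : pb.Regular Lf) (hLf : 0 ≤ Lf) (hμ : 4 * Lf ≤ μ) (hμ2 : 2 ≤ μ)
    (hρ : 0 ≤ ρ) {τhat : ℝ} (hτ : 0 < τhat) (hτle : τhat * (Lf + ρ * ‖pb.A‖ ^ 2 + μ) ≤ 1)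
    {ω : ℝ} (hω : 0 ≤ ω) :
    ∃ K : ℝ, 0 < K ∧ ∀ (η : ℝ), 0 ≤ η → ‖pb.A‖ * η ≤ ω →
      ∀ (q : Vec n × Vec m × Vec n) (err : Vec n),
      ‖pb.A (pb.outPoint ρ μ τhat q.1 (pb.dualStep η q.1 q.2.1) q.2.2 err) - pb.b‖ ^ 2 ≤
          K * (pb.residual ρ μ q + ‖err‖ ^ 2) ∧
        ‖pb.outCertificate ρ μ τhat q.1 (pb.dualStep η q.1 q.2.1) q.2.2 err‖ ^ 2 ≤
          K * (pb.residual ρ μ q + ‖err‖ ^ 2) := by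
  have hμ0 : 0 < μ := by linarith
  set a := ‖pb.A‖ with ha
  have ha0 : 0 ≤ a := norm_nonneg _
  set k₁ := 1 + ω * (1 + a) with hk₁
  have hk₁0 : 0 ≤ k₁ := by positivity
  set k₂ := 3 * k₁ + 1 with hk₂
  have hk₂0 : 0 ≤ k₂ := by positivity
  set k₃ := 1 + a + a * k₂ + (τhat⁻¹ * k₂ + 1 + Lf * k₂ + ρ * (a * (1 + a)) + μ) with hk₃
  have hk₃0 : 0 < k₃ := by positivity
  refine ⟨4 * k₃ ^ 2, by positivity, ?_⟩
  rintro η hη hηω ⟨x, y, z⟩ err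
  dsimp only
  set y' := pb.dualStep η x y with hy'
  set xs := pb.xStar ρ μ y z with hxs
  set xt := pb.xStar ρ μ y' z with hxt
  set xh := pb.outPoint ρ μ τhat x y' z err with hxh
  -- all quantities are estimated by multiples of the sum `N` of the elementary ones
  set N := ‖x - xs‖ + ‖pb.A xs - pb.b‖ + ‖x - z‖ + ‖err‖ with hN
  have n1 := norm_nonneg (x - xs)
  have n2 := norm_nonneg (pb.A xs - pb.b)
  have n3 := norm_nonneg (x - z)
  have n4 := norm_nonneg err
  have hN0 : 0 ≤ N := by positivity
  have hNsq : N ^ 2 ≤ 4 * (pb.residual ρ μ (x, y, z) + ‖err‖ ^ 2) := by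
    simp only [residual, ← hxs, hN]
    linarith [sq_nonneg (‖x - xs‖ - ‖pb.A xs - pb.b‖), sq_nonneg (‖x - xs‖ - ‖x - z‖),
      sq_nonneg (‖x - xs‖ - ‖err‖), sq_nonneg (‖pb.A xs - pb.b‖ - ‖x - z‖),
      sq_nonneg (‖pb.A xs - pb.b‖ - ‖err‖), sq_nonneg (‖x - z‖ - ‖err‖)]
  have hq : ‖pb.A x - pb.b‖ ≤ (1 + a) * N := by
    have e1 : pb.A x - pb.b = (pb.A xs - pb.b) + pb.A (x - xs) := by
      rw [map_sub]; abel
    have e2 : ‖pb.A x - pb.b‖ ≤ ‖pb.A xs - pb.b‖ + a * ‖x - xs‖ := by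
      rw [e1]
      exact (norm_add_le _ _).trans (add_le_add le_rfl (pb.A.le_opNorm _))
    have e3 : a * ‖x - xs‖ ≤ a * N := mul_le_mul_of_nonneg_left (by linarith) ha0
    linarith
  have hxt1 : ‖x - xt‖ ≤ k₁ * N := by
    have e0 := norm_xStar_sub_le h hμ hμ0 hρ y y' z z
    have e1 : ‖y - y'‖ = η * ‖pb.A x - pb.b‖ := by
      rw [hy', dualStep, sub_add_cancel_left, norm_neg, norm_smul, Real.norm_of_nonneg hη]
    rw [e1, sub_self, norm_zero, mul_zero, add_zero, ← ha, ← mul_assoc] at e0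
    have e2 : a * η * ‖pb.A x - pb.b‖ ≤ ω * ((1 + a) * N) :=
      mul_le_mul hηω hq (norm_nonneg _) hω
    have e3 : 1 * ‖xs - xt‖ ≤ 3 / 4 * μ * ‖xs - xt‖ :=
      mul_le_mul_of_nonneg_right (by linarith) (norm_nonneg _)
    have e4 := norm_sub_le_norm_sub_add_norm_sub x xs xt
    rw [hk₁]
    linarith
  have hxh1 : ‖xh - xt‖ ≤ (2 * k₁ + 1) * N := by
    have e1 := norm_projOn_step_sub_le h hμ hμ0 hρ hτ.le x y' z err
    rw [← hxt] at e1
    have e2 := proxGrad_lipschitz h hμ0.le hρ y' z x xt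
    have e3 := norm_sub_le (x - xt - τhat • (pb.proxGrad ρ μ y' z x - pb.proxGrad ρ μ y' z xt))
      (τhat • err)
    have e4 := norm_sub_le (x - xt) (τhat • (pb.proxGrad ρ μ y' z x - pb.proxGrad ρ μ y' z xt))
    rw [norm_smul, Real.norm_of_nonneg hτ.le] at e3 e4
    have e5 : τhat * ‖pb.proxGrad ρ μ y' z x - pb.proxGrad ρ μ y' z xt‖ ≤ 1 * ‖x - xt‖ := by
      refine (mul_le_mul_of_nonneg_left e2 hτ.le).trans ?_
      rw [← mul_assoc]
      exact mul_le_mul_of_nonneg_right hτle (norm_nonneg _)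
    have e6 : τhat ≤ 1 := by
      have : 1 ≤ Lf + ρ * a ^ 2 + μ := by
        have : 0 ≤ ρ * a ^ 2 := by positivity
        linarith
      nlinarith
    have e7 : τhat * ‖err‖ ≤ 1 * N := mul_le_mul e6 (by linarith) n4 zero_le_one
    change ‖xh - xt‖ ≤ _ at e1
    linarith
  have hxxh : ‖x - xh‖ ≤ k₂ * N := by
    have := norm_sub_le_norm_sub_add_norm_sub x xt xh
    rw [norm_sub_rev xt xh] at this
    rw [hk₂]
    linarith
  have hfeas : ‖pb.A xh - pb.b‖ ≤ k₃ * N := by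
    have e1 : pb.A xh - pb.b = (pb.A x - pb.b) - pb.A (x - xh) := by
      rw [map_sub]; abel
    have e2 : ‖pb.A xh - pb.b‖ ≤ ‖pb.A x - pb.b‖ + a * ‖x - xh‖ := by
      rw [e1]
      exact (norm_sub_le _ _).trans (add_le_add le_rfl (pb.A.le_opNorm _))
    have e3 := mul_le_mul_of_nonneg_left hxxh ha0
    have e4 : 0 ≤ (τhat⁻¹ * k₂ + 1 + Lf * k₂ + ρ * (a * (1 + a)) + μ) * N := by positivity
    rw [hk₃]
    linarith
  have hcert : ‖pb.outCertificate ρ μ τhat x y' z err‖ ≤ k₃ * N := by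
    have e1 : pb.outCertificate ρ μ τhat x y' z err = τhat⁻¹ • (x - xh) - err +
        (gradient pb.f xh - gradient pb.f x) - ρ • adjoint pb.A (pb.A x - pb.b) -
          μ • (x - z) := by
      simp only [outCertificate, ← hxh, proxGrad]
      abel
    have e2 : ‖τhat⁻¹ • (x - xh)‖ ≤ τhat⁻¹ * (k₂ * N) := by
      rw [norm_smul, Real.norm_of_nonneg (inv_nonneg.2 hτ.le)]
      exact mul_le_mul_of_nonneg_left hxxh (inv_nonneg.2 hτ.le)
    have e3 : ‖gradient pb.f xh - gradient pb.f x‖ ≤ Lf * (k₂ * N) := by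
      refine (h.gradient_lipschitz xh x).trans (mul_le_mul_of_nonneg_left ?_ hLf)
      rwa [norm_sub_rev]
    have e4 : ‖ρ • adjoint pb.A (pb.A x - pb.b)‖ ≤ ρ * (a * ((1 + a) * N)) := by
      rw [norm_smul, Real.norm_of_nonneg hρ]
      exact mul_le_mul_of_nonneg_left ((norm_adjoint_apply_le _ _).trans
        (mul_le_mul_of_nonneg_left hq ha0)) hρ
    have e5 : ‖μ • (x - z)‖ ≤ μ * N := by
      rw [norm_smul, Real.norm_of_nonneg hμ0.le]
      exact mul_le_mul_of_nonneg_left (by linarith) hμ0.le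
    have e6 : 0 ≤ (1 + a + a * k₂) * N := by positivity
    rw [e1]
    have t1 := norm_sub_le (τhat⁻¹ • (x - xh) - err + (gradient pb.f xh - gradient pb.f x) -
      ρ • adjoint pb.A (pb.A x - pb.b)) (μ • (x - z))
    have t2 := norm_sub_le (τhat⁻¹ • (x - xh) - err + (gradient pb.f xh - gradient pb.f x))
      (ρ • adjoint pb.A (pb.A x - pb.b))
    have t3 := norm_add_le (τhat⁻¹ • (x - xh) - err) (gradient pb.f xh - gradient pb.f x)
    have t4 := norm_sub_le (τhat⁻¹ • (x - xh)) err
    rw [hk₃]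
    linarith
  have hfin : ∀ t : ℝ, 0 ≤ t → t ≤ k₃ * N →
      t ^ 2 ≤ 4 * k₃ ^ 2 * (pb.residual ρ μ (x, y, z) + ‖err‖ ^ 2) := by
    intro t ht0 ht
    have e1 : t ^ 2 ≤ (k₃ * N) ^ 2 := by gcongr
    have e2 := mul_le_mul_of_nonneg_left hNsq (sq_nonneg k₃)
    linarith
  exact ⟨hfin _ (norm_nonneg _) hfeas, hfin _ (norm_nonneg _) hcert⟩

variable {S Ω : Type*} [MeasurableSpace S] [MeasurableSpace Ω] {P : Measure Ω} {Q : Measure S}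
  {F : Vec n → S → Vec n} {σ : ℝ} {ξ : ℕ → Ω → S} {T : ℕ} {tstar : Ω → ℕ}

/-- The mean of the noise at `x` over the `B` samples that follow the first `k`. -/
def noiseMean {S : Type*} (f : Vec n → ℝ) (F : Vec n → S → Vec n) (k B : ℕ) (x : Vec n)
    (u : ℕ → S) : Vec n :=
  (1 / (B : ℝ)) • ∑ i ∈ Finset.range B, (F x (u (k + i)) - gradient f x)

theorem miniBatchGrad_eq {S : Type*} (F : Vec n → S → Vec n) (u : ℕ → S) (k : ℕ) {B : ℕ}
    (hB : 0 < B) (x : Vec n) (y : Vec m) (z : Vec n) :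
    pb.miniBatchGrad ρ μ F u k B x y z =
      pb.proxGrad ρ μ y z x + noiseMean pb.f F k B x u := by
  have hB' : (B : ℝ) ≠ 0 := by exact_mod_cast hB.ne'
  simp only [miniBatchGrad, noiseMean, stochGrad_eq, Finset.sum_add_distrib, Finset.sum_const,
    Finset.card_range, smul_add]
  rw [← Nat.cast_smul_eq_nsmul ℝ, smul_smul, one_div_mul_cancel hB', one_smul]

theorem procedure_eq {S : Type*} (par : AlgParams) (τhat : ℝ) (F : Vec n → S → Vec n) (u : ℕ → S)
    (x₀ : Vec n) (y₀ : Vec m) (T : ℕ) {B : ℕ} (hB : 0 < B) (t : ℕ) :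
    pb.procedure par τhat F u x₀ y₀ T B t =
      ⟨pb.outPoint par.ρ par.μ τhat (pb.runMap par F x₀ y₀ t u).1
          (pb.dualStep par.η (pb.runMap par F x₀ y₀ t u).1 (pb.runMap par F x₀ y₀ t u).2.1)
          (pb.runMap par F x₀ y₀ t u).2.2
          (noiseMean pb.f F T B (pb.runMap par F x₀ y₀ t u).1 u),
        pb.dualStep par.η (pb.runMap par F x₀ y₀ t u).1 (pb.runMap par F x₀ y₀ t u).2.1,
        T + B⟩ := by
  simp only [procedure, algRun_eq, miniBatchGrad_eq F u _ hB, outPoint]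

theorem measurable_noiseMean (h : pb.Regular Lf) (hLf : 0 ≤ Lf)
    (hF : Measurable (Function.uncurry F)) (k B : ℕ) {x : (ℕ → S) → Vec n} (hx : Measurable x) :
    Measurable fun u => noiseMean pb.f F k B (x u) u := by
  have hgrad := (h.continuous_gradient hLf).measurable
  exact (Finset.measurable_sum _ fun i _ => (hF.comp (hx.prodMk (measurable_pi_apply (k + i)))).sub
    (hgrad.comp hx)).const_smul (1 / (B : ℝ))

variable [IsProbabilityMeasure Q] [IsProbabilityMeasure P]

theorem lintegral_noiseMean_le (h : pb.Regular Lf) (hLf : 0 ≤ Lf) (par : AlgParams)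
    (hF : IsStochasticOracle pb.f σ Q F) (hs : IsSampling P Q ξ T tstar) (x₀ : Vec n) (y₀ : Vec m)
    {t : ℕ} (ht : t ≤ T) {B : ℕ} (hB : 0 < B) :
    ∫⁻ ω, ENNReal.ofReal (‖noiseMean pb.f F T B (pb.runMap par F x₀ y₀ t fun i => ξ i ω).1
      (fun i => ξ i ω)‖ ^ 2) ∂P ≤ ENNReal.ofReal (σ ^ 2 / B) := by
  have h1 := lintegral_noise_sum_le h hLf par hF hs x₀ y₀ ht B
  have hB' : (0 : ℝ) < B := by exact_mod_cast hB
  simp only [noiseMean, norm_smul, mul_pow]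
  simp only [ENNReal.ofReal_mul (sq_nonneg ‖1 / (B : ℝ)‖)]
  rw [lintegral_const_mul' _ _ ENNReal.ofReal_ne_top]
  refine (mul_le_mul_right h1 _).trans (le_of_eq ?_)
  rw [← ENNReal.ofReal_mul (sq_nonneg _), Real.norm_of_nonneg (by positivity)]
  congr 1
  field_simp

/-- The expectation, at the random index, of the residual and of the minibatch error. -/
theorem lintegral_residual_tstar_le {par : AlgParams} {c C₁ K : ℝ} (h : pb.Regular Lf)
    (hLf : 0 ≤ Lf) (hμ : 4 * Lf ≤ par.μ) (hμ0 : 0 < par.μ) (hρ : 0 ≤ par.ρ)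
    (hF : IsStochasticOracle pb.f σ Q F) (hs : IsSampling P Q ξ T tstar) (hT : 0 < T) {B : ℕ}
    (hB : 0 < B) (hc : 0 < c) (hC₁ : 0 ≤ C₁) (hK : 0 ≤ K) (x₀ : Vec n) (y₀ : Vec m)
    (hsum : ∑ t ∈ Finset.Icc 1 T, ∫⁻ ω, ENNReal.ofReal (c * pb.residual par.ρ par.μ
        (pb.runMap par F x₀ y₀ t fun i => ξ i ω)) ∂P ≤ ENNReal.ofReal C₁) :
    ∫⁻ ω, ENNReal.ofReal (K * (pb.residual par.ρ par.μ
        (pb.runMap par F x₀ y₀ (tstar ω) fun i => ξ i ω) +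
      ‖noiseMean pb.f F T B (pb.runMap par F x₀ y₀ (tstar ω) fun i => ξ i ω).1
        (fun i => ξ i ω)‖ ^ 2)) ∂P ≤
      ENNReal.ofReal (K * C₁ / (c * T) + K * σ ^ 2 / B) := by
  have hT' : (0 : ℝ) < T := by exact_mod_cast hT
  have hB' : (0 : ℝ) < B := by exact_mod_cast hB
  have hR := measurable_runMap h par hF.measurable x₀ y₀
  have hres := (continuous_residual h hμ hμ0 hρ).measurable
  have hres0 : ∀ q, 0 ≤ pb.residual par.ρ par.μ q := fun q => by unfold residual; positivity
  have hg1 : ∀ t, Measurable fun u : ℕ → S => pb.residual par.ρ par.μ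
      (pb.runMap par F x₀ y₀ t u) := fun t => hres.comp (hR t)
  have hg2 : ∀ t, Measurable fun u : ℕ → S => ‖noiseMean pb.f F T B
      (pb.runMap par F x₀ y₀ t u).1 u‖ ^ 2 := fun t =>
    (measurable_noiseMean h hLf hF.measurable T B (hR t).fst).norm.pow_const 2
  rw [hs.lintegral_tstar hT (g := fun t u => ENNReal.ofReal (K * (pb.residual par.ρ par.μ
        (pb.runMap par F x₀ y₀ t u) + ‖noiseMean pb.f F T B (pb.runMap par F x₀ y₀ t u).1 u‖ ^ 2)))
    fun t => (((hg1 t).add (hg2 t)).const_mul K).ennreal_ofReal]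
  have hterm : ∀ t ∈ Finset.Icc 1 T, ∫⁻ ω, ENNReal.ofReal (K * (pb.residual par.ρ par.μ
        (pb.runMap par F x₀ y₀ t fun i => ξ i ω) + ‖noiseMean pb.f F T B
          (pb.runMap par F x₀ y₀ t fun i => ξ i ω).1 (fun i => ξ i ω)‖ ^ 2)) ∂P ≤
      ENNReal.ofReal (K / c) * ∫⁻ ω, ENNReal.ofReal (c * pb.residual par.ρ par.μ
        (pb.runMap par F x₀ y₀ t fun i => ξ i ω)) ∂P + ENNReal.ofReal (K * (σ ^ 2 / B)) := by
    intro t ht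
    have e1 : ∀ u : ℕ → S, ENNReal.ofReal (K * (pb.residual par.ρ par.μ
        (pb.runMap par F x₀ y₀ t u) + ‖noiseMean pb.f F T B
          (pb.runMap par F x₀ y₀ t u).1 u‖ ^ 2)) =
        ENNReal.ofReal (K / c) * ENNReal.ofReal (c * pb.residual par.ρ par.μ
          (pb.runMap par F x₀ y₀ t u)) +
        ENNReal.ofReal K * ENNReal.ofReal (‖noiseMean pb.f F T B
          (pb.runMap par F x₀ y₀ t u).1 u‖ ^ 2) := by
      intro u
      have := hres0 (pb.runMap par F x₀ y₀ t u)
      rw [← ENNReal.ofReal_mul (by positivity), ← ENNReal.ofReal_mul hK,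
        ← ENNReal.ofReal_add (by positivity) (by positivity)]
      congr 1
      field_simp
    have e2 : Measurable fun ω => ENNReal.ofReal (K / c) * ENNReal.ofReal
        (c * pb.residual par.ρ par.μ (pb.runMap par F x₀ y₀ t fun i => ξ i ω)) :=
      ((((hg1 t).comp hs.measurable_stream).const_mul c).ennreal_ofReal).const_mul _
    simp only [e1]
    rw [lintegral_add_left e2, lintegral_const_mul' _ _ ENNReal.ofReal_ne_top,
      lintegral_const_mul' _ _ ENNReal.ofReal_ne_top, ENNReal.ofReal_mul hK]
    exact add_le_add le_rfl (mul_le_mul_right (lintegral_noiseMean_le h hLf par hF hs x₀ y₀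
      (Finset.mem_Icc.1 ht).2 hB) _)
  have hT1 : (T : ENNReal)⁻¹ = ENNReal.ofReal (1 / T) := by
    rw [one_div, ENNReal.ofReal_inv_of_pos hT', ENNReal.ofReal_natCast]
  calc _ ≤ (T : ENNReal)⁻¹ * (ENNReal.ofReal (K / c) * ENNReal.ofReal C₁ +
        T * ENNReal.ofReal (K * (σ ^ 2 / B))) := by
        refine mul_le_mul_right ((Finset.sum_le_sum hterm).trans ?_) _
        rw [Finset.sum_add_distrib, ← Finset.mul_sum]
        refine add_le_add (mul_le_mul_right hsum _) (le_of_eq ?_)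
        simp
    _ = _ := by
        rw [hT1, ← ENNReal.ofReal_natCast, ← ENNReal.ofReal_mul (by positivity),
          ← ENNReal.ofReal_mul (by positivity), ← ENNReal.ofReal_add (by positivity)
            (by positivity), ← ENNReal.ofReal_mul (by positivity)]
        congr 1
        field_simp

theorem measurable_outPoint (h : pb.Regular Lf) (hLf : 0 ≤ Lf) (ρ μ τhat : ℝ) {x z err : Ω → Vec n}
    {y : Ω → Vec m} (hx : Measurable x) (hy : Measurable y) (hz : Measurable z)
    (he : Measurable err) :
    Measurable (fun ω => pb.outPoint ρ μ τhat (x ω) (y ω) (z ω) (err ω)) ∧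
      Measurable (fun ω => pb.outCertificate ρ μ τhat (x ω) (y ω) (z ω) (err ω)) := by
  have hproj := (continuous_projOn pb.isClosed_X pb.convex_X h.X_nonempty).measurable
  have hgrad := (h.continuous_gradient hLf).measurable
  have hG : Measurable fun ω => pb.proxGrad ρ μ (y ω) (z ω) (x ω) + err ω := by
    unfold proxGrad
    fun_prop
  have h1 : Measurable (fun ω => pb.outPoint ρ μ τhat (x ω) (y ω) (z ω) (err ω)) :=
    hproj.comp (hx.sub (hG.const_smul τhat))
  refine ⟨h1, ?_⟩
  have hA : Measurable fun ω => adjoint pb.A (y ω) := by fun_prop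
  exact (((hx.sub h1).const_smul τhat⁻¹).sub hG).add ((hgrad.comp h1).add hA)

end LinConProblem

/-! ### The step sizes and the complexity bound -/

theorem two_le_muParam (Lf : ℝ) : 2 ≤ muParam Lf := le_max_left _ _

theorem four_mul_le_muParam (Lf : ℝ) : 4 * Lf ≤ muParam Lf := le_max_right _ _

section Params

variable {Lf ρ a σbar : ℝ} (hLf : 0 ≤ Lf) (hρ : 0 ≤ ρ) (ha : 0 < a) (hσ : 0 < σbar)

theorem tauParam_eq (T : ℕ) : tauParam Lf ρ a T = tauParam Lf ρ a 1 / √T := by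
  simp only [tauParam, Nat.cast_one, Real.sqrt_one, mul_one]
  rw [div_div]

include hLf hρ

theorem muParam_le_LKParam : muParam Lf ≤ LKParam Lf ρ a := by
  have : 0 ≤ ρ * a ^ 2 := by positivity
  rw [LKParam]
  linarith

theorem LKParam_pos : 0 < LKParam Lf ρ a :=
  lt_of_lt_of_le (by linarith [two_le_muParam Lf]) (muParam_le_LKParam hLf hρ)

theorem tauParam_pos {T : ℕ} (hT : 0 < T) : 0 < tauParam Lf ρ a T := by
  have := LKParam_pos (a := a) hLf hρ
  have : (0 : ℝ) < T := by exact_mod_cast hT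
  unfold tauParam
  positivity

include ha

theorem etaParam_pos {T : ℕ} (hT : 0 < T) : 0 < etaParam Lf ρ a T := by
  have h1 := tauParam_pos (a := a) hLf hρ hT
  have h2 := two_le_muParam Lf
  have h3 : 0 < 2 * muParam Lf + ρ * a ^ 2 := by positivity
  unfold etaParam
  refine lt_min (by positivity) (lt_min (by positivity) (by positivity))

/-- A minimum of terms proportional to `1/√T` and of constants decreases at most like `1/√T`. -/
theorem etaParam_one_div_sqrt_le {T : ℕ} (hT : 0 < T) :
    etaParam Lf ρ a 1 / √T ≤ etaParam Lf ρ a T := by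
  have hT1 : (1 : ℝ) ≤ √T := Real.one_le_sqrt.2 (by exact_mod_cast hT)
  have hT0 : 0 < √(T : ℝ) := by linarith
  have h2 := two_le_muParam Lf
  have h3 : 0 < 2 * muParam Lf + ρ * a ^ 2 := by positivity
  conv_rhs => rw [etaParam, tauParam_eq T]
  refine le_min ?_ (le_min ?_ ?_)
  · refine (div_le_self (etaParam_pos hLf hρ ha one_pos).le hT1).trans (min_le_left _ _)
  · rw [div_right_comm]
    exact div_le_div_of_nonneg_right ((min_le_right _ _).trans (min_le_left _ _)) hT0.le
  · rw [div_mul_eq_mul_div, div_right_comm]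
    exact div_le_div_of_nonneg_right ((min_le_right _ _).trans (min_le_right _ _)) hT0.le

include hσ

theorem betaParam_pos {T : ℕ} (hT : 0 < T) : 0 < betaParam Lf ρ a σbar T := by
  have h1 := tauParam_pos (a := a) hLf hρ hT
  have h2 := two_le_muParam Lf
  have h3 := etaParam_pos hLf hρ ha hT
  have h4 := LKParam_pos (a := a) hLf hρ
  unfold betaParam
  refine lt_min (by positivity) (lt_min (by positivity) (by positivity))

theorem betaParam_one_div_sqrt_le {T : ℕ} (hT : 0 < T) :
    betaParam Lf ρ a σbar 1 / √T ≤ betaParam Lf ρ a σbar T := by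
  have hT1 : (1 : ℝ) ≤ √T := Real.one_le_sqrt.2 (by exact_mod_cast hT)
  have hT0 : 0 < √(T : ℝ) := by linarith
  have h2 := two_le_muParam Lf
  conv_rhs => rw [betaParam, tauParam_eq T]
  refine le_min ?_ (le_min ?_ ?_)
  · rw [div_right_comm]
    exact div_le_div_of_nonneg_right (min_le_left _ _) hT0.le
  · exact (div_le_self (betaParam_pos hLf hρ ha hσ one_pos).le hT1).trans
      ((min_le_right _ _).trans (min_le_left _ _))
  · refine le_trans ?_ (div_le_div_of_nonneg_right (etaParam_one_div_sqrt_le hLf hρ ha hT)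
      (by positivity))
    rw [div_right_comm]
    exact div_le_div_of_nonneg_right ((min_le_right _ _).trans (min_le_right _ _)) hT0.le

theorem stepSizes_algParams {T : ℕ} (hT : 0 < T) :
    StepSizes (muParam Lf) (LKParam Lf ρ a) a σbar (tauParam Lf ρ a T) (etaParam Lf ρ a T)
      (betaParam Lf ρ a σbar T) where
  two_le_μ := two_le_muParam Lf
  μ_le_lam := muParam_le_LKParam hLf hρ
  a_nonneg := ha.le
  τ_pos := tauParam_pos hLf hρ hT
  η_pos := etaParam_pos hLf hρ ha hT
  β_pos := betaParam_pos hLf hρ ha hσ hT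
  τ_le := by
    have hT1 : (1 : ℝ) ≤ √T := Real.one_le_sqrt.2 (by exact_mod_cast hT)
    have h4 := LKParam_pos (a := a) hLf hρ
    have : 6 * (tauParam Lf ρ a T * LKParam Lf ρ a ^ 2) = 1 / √T := by
      rw [tauParam]
      field_simp
    rw [this]
    exact (div_le_one (by linarith)).2 hT1
  η_le := by
    have h1 : etaParam Lf ρ a T ≤ tauParam Lf ρ a T / (200 * a ^ 2) :=
      (min_le_right _ _).trans (min_le_left _ _)
    rw [le_div_iff₀ (by positivity)] at h1
    linarith
  β_le_τ := by
    have h1 : betaParam Lf ρ a σbar T ≤ tauParam Lf ρ a T / 100 := min_le_left _ _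
    linarith
  β_le_η := by
    have h2 := two_le_muParam Lf
    have h1 : betaParam Lf ρ a σbar T ≤ etaParam Lf ρ a T / (36 * muParam Lf * σbar ^ 2) :=
      (min_le_right _ _).trans (min_le_right _ _)
    rw [le_div_iff₀ (by positivity)] at h1
    linarith

end Params

namespace LinConProblem

variable {n m p : ℕ} {pb : LinConProblem n m p}

set_option maxHeartbeats 1000000 in
/-- The mean-square accuracy of the output after `T` iterations and with a minibatch of size `B` is
`D / √T + E / B`, with constants that depend only on the problem and on `σ`, `σbar`, `x₀`, `y₀`,
`τhat`. -/
theorem exists_output_rate {Lf ρ σbar τhat : ℝ} (h : pb.Regular Lf) (hA : pb.A ≠ 0)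
    (hLf : 0 ≤ Lf) (hρ : 0 ≤ ρ) (hσbar : 0 < σbar)
    (hσ : pb.IsErrorBoundConst ρ (muParam Lf) σbar) (σ : ℝ) (x₀ : Vec n) (y₀ : Vec m)
    (hτ : 0 < τhat) (hτle : τhat ≤ 1 / LKParam Lf ρ ‖pb.A‖) :
    ∃ D E : ℝ, 0 ≤ D ∧ 0 ≤ E ∧ ∀ T B : ℕ, 0 < T → 0 < B →
      ∀ {S Ω : Type*} [MeasurableSpace S] [MeasurableSpace Ω]
        (Q : Measure S) [IsProbabilityMeasure Q] (P : Measure Ω) [IsProbabilityMeasure P]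
        (F : Vec n → S → Vec n) (ξ : ℕ → Ω → S) (tstar : Ω → ℕ),
        IsStochasticOracle pb.f σ Q F → IsSampling P Q ξ T tstar →
        ∀ ε : ℝ, D / √T + E / B ≤ ε ^ 2 →
        pb.IsEpsStationary P
          (fun ω => (pb.procedure (algParams Lf ρ ‖pb.A‖ σbar T) τhat F (fun k => ξ k ω) x₀ y₀
            T B (tstar ω)).x)
          (fun ω => (pb.procedure (algParams Lf ρ ‖pb.A‖ σbar T) τhat F (fun k => ξ k ω) x₀ y₀
            T B (tstar ω)).y) ε := by
  have ha : 0 < ‖pb.A‖ := norm_pos_iff.2 hA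
  have hμ2 := two_le_muParam Lf
  have hμ := four_mul_le_muParam Lf
  have hμ0 : 0 < muParam Lf := by linarith
  have hLK := LKParam_pos (a := ‖pb.A‖) hLf hρ
  obtain ⟨flow, hflow⟩ := h.bddBelow
  set τ₁ := tauParam Lf ρ ‖pb.A‖ 1 with hτ₁
  set η₁ := etaParam Lf ρ ‖pb.A‖ 1 with hη₁
  set β₁ := betaParam Lf ρ ‖pb.A‖ σbar 1 with hβ₁
  have hτ₁0 : 0 < τ₁ := tauParam_pos hLf hρ one_pos
  have hη₁0 : 0 < η₁ := etaParam_pos hLf hρ ha one_pos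
  have hβ₁0 : 0 < β₁ := betaParam_pos hLf hρ ha hσbar one_pos
  -- `c₀ / √T` is the rate at which the residual is subtracted from the potential
  set c₀ := min (τ₁ * muParam Lf / 2) (min (η₁ / 2) (muParam Lf * β₁ / 4)) with hc₀
  have hc₀0 : 0 < c₀ := lt_min (by positivity) (lt_min (by positivity) (by positivity))
  set Φ₀ := pb.potential ρ (muParam Lf) (x₀, y₀, x₀) - flow with hΦ₀
  have hΦ₀0 : 0 ≤ Φ₀ := by
    have h1 := le_neg_dualValue_add h hμ hμ0 hρ hflow y₀ x₀
    have h2 : 0 ≤ ‖x₀ - pb.xStar ρ (muParam Lf) y₀ x₀‖ ^ 2 := by positivity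
    simp only [hΦ₀, potential]
    linarith
  set C₁ := Φ₀ + 4 * (τ₁ ^ 2 * σ ^ 2) with hC₁
  have hC₁0 : 0 ≤ C₁ := by positivity
  set ω₁ := ‖pb.A‖ * ((2 * muParam Lf + ρ * ‖pb.A‖ ^ 2) / (4 * ‖pb.A‖ ^ 4)) with hω₁
  obtain ⟨K, hK0, hK⟩ := exists_outPoint_bound h hLf hμ hμ2 hρ hτ
    (by rwa [le_div_iff₀ hLK] at hτle) (show 0 ≤ ω₁ by positivity)
  refine ⟨K * C₁ / c₀, K * σ ^ 2, by positivity, by positivity, ?_⟩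
  intro T B hT hB S Ω _ _ Q _ P _ F ξ tstar hF hs ε hε
  have hT' : (0 : ℝ) < T := by exact_mod_cast hT
  have hT1 : (1 : ℝ) ≤ T := by exact_mod_cast hT
  have hsT : 0 < √(T : ℝ) := Real.sqrt_pos.2 hT'
  have hsT2 : √(T : ℝ) * √T = T := Real.mul_self_sqrt hT'.le
  set par := algParams Lf ρ ‖pb.A‖ σbar T with hpar
  have hst : StepSizes par.μ (LKParam Lf ρ ‖pb.A‖) ‖pb.A‖ σbar par.τ par.η par.β :=
    stepSizes_algParams hLf hρ ha hσbar hT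
  have hparτ : par.τ = τ₁ / √T := tauParam_eq T
  have hcT0 : 0 < c₀ / √T := by positivity
  have hc1 : c₀ / √T ≤ par.τ * par.μ / 2 := by
    rw [hparτ, div_mul_eq_mul_div, div_right_comm]
    exact div_le_div_of_nonneg_right (min_le_left _ _) hsT.le
  have hc2 : c₀ / √T ≤ par.η / 2 := by
    refine le_trans ?_ (div_le_div_of_nonneg_right (etaParam_one_div_sqrt_le hLf hρ ha hT)
      zero_le_two)
    rw [div_right_comm]
    exact div_le_div_of_nonneg_right ((min_le_right _ _).trans (min_le_left _ _)) hsT.le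
  have hc3 : c₀ / √T ≤ par.μ * par.β / 4 := by
    have h1 := mul_le_mul_of_nonneg_left (betaParam_one_div_sqrt_le hLf hρ ha hσbar hT) hμ0.le
    refine le_trans ?_ (div_le_div_of_nonneg_right h1 zero_le_four)
    rw [← mul_div_assoc, div_right_comm]
    exact div_le_div_of_nonneg_right ((min_le_right _ _).trans (min_le_right _ _)) hsT.le
  have hsum := sum_lintegral_residual_le (par := par) (lam := LKParam Lf ρ ‖pb.A‖) h hμ hρ rfl
    hst hσ hF hflow hcT0.le hc1 hc2 hc3 hs x₀ y₀ (T + 1)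
  change _ ≤ ENNReal.ofReal Φ₀ + _ at hsum
  have hsum' : ∑ t ∈ Finset.Icc 1 T, ∫⁻ ω, ENNReal.ofReal (c₀ / √T * pb.residual par.ρ par.μ
        (pb.runMap par F x₀ y₀ t fun i => ξ i ω)) ∂P ≤ ENNReal.ofReal C₁ := by
    refine (Finset.sum_le_sum_of_subset (t := Finset.range (T + 1)) ?_).trans
      (le_add_self.trans (hsum.trans ?_))
    · intro t ht
      have := Finset.mem_Icc.1 ht
      exact Finset.mem_range.2 (by omega)
    · rw [← ENNReal.ofReal_natCast, ← ENNReal.ofReal_mul (by positivity),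
        ← ENNReal.ofReal_add hΦ₀0 (by positivity)]
      refine ENNReal.ofReal_le_ofReal (add_le_add le_rfl ?_)
      have e1 : par.τ ^ 2 = τ₁ ^ 2 / T := by
        rw [hparτ, div_pow, Real.sq_sqrt hT'.le]
      rw [e1]
      have e2 : ((T + 1 : ℕ) : ℝ) * (2 * (τ₁ ^ 2 / T * σ ^ 2)) =
          2 * (τ₁ ^ 2 * σ ^ 2) * ((T + 1) / T) := by
        push_cast
        field_simp
      have e3 : ((T : ℝ) + 1) / T ≤ 2 := by
        rw [div_le_iff₀ hT']
        linarith
      rw [e2]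
      have := mul_le_mul_of_nonneg_left e3 (show 0 ≤ 2 * (τ₁ ^ 2 * σ ^ 2) by positivity)
      linarith
  have hmain := lintegral_residual_tstar_le (par := par) (K := K) h hLf hμ hμ0 hρ hF hs hT hB
    hcT0 hC₁0 hK0.le x₀ y₀ hsum'
  have hrate : K * C₁ / (c₀ / √T * T) + K * σ ^ 2 / B = K * C₁ / c₀ / √T + K * σ ^ 2 / B := by
    have e1 : c₀ / √T * T = c₀ * √T := by
      rw [div_mul_eq_mul_div, div_eq_iff hsT.ne', mul_assoc, hsT2]
    rw [e1, div_div]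
  rw [hrate] at hmain
  have hηω : ‖pb.A‖ * par.η ≤ ω₁ := mul_le_mul_of_nonneg_left (min_le_left _ _) ha.le
  have hmono := ENNReal.ofReal_le_ofReal hε
  simp only [procedure_eq par τhat F _ x₀ y₀ T hB]
  -- measurability of the random state at the random index
  have hstar : ∀ {γ : Type} [MeasurableSpace γ] (G : ℕ → (ℕ → S) → γ), (∀ t, Measurable (G t)) →
      Measurable fun ω => G (tstar ω) fun i => ξ i ω := by
    intro γ _ G hG
    have h1 : Measurable fun q : ℕ × (ℕ → S) => G q.1 q.2 :=
      measurable_from_prod_countable_right hG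
    exact h1.comp (hs.measurable_tstar.prodMk hs.measurable_stream)
  have hR := measurable_runMap h par hF.measurable x₀ y₀
  have hRm := hstar (fun t u => pb.runMap par F x₀ y₀ t u) hR
  have hNm := hstar (fun t u => noiseMean pb.f F T B (pb.runMap par F x₀ y₀ t u).1 u)
    fun t => measurable_noiseMean h hLf hF.measurable T B (hR t).fst
  have hYm : Measurable fun ω => pb.dualStep par.η
      (pb.runMap par F x₀ y₀ (tstar ω) fun i => ξ i ω).1
      (pb.runMap par F x₀ y₀ (tstar ω) fun i => ξ i ω).2.1 := by
    have h1 := hRm.fst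
    have h2 := hRm.snd.fst
    unfold dualStep
    fun_prop
  obtain ⟨hxm, hvm⟩ := measurable_outPoint h hLf par.ρ par.μ τhat hRm.fst hYm hRm.snd.snd hNm
  have hAm : Measurable fun ω => pb.A (pb.outPoint par.ρ par.μ τhat
      (pb.runMap par F x₀ y₀ (tstar ω) fun i => ξ i ω).1
      (pb.dualStep par.η (pb.runMap par F x₀ y₀ (tstar ω) fun i => ξ i ω).1
        (pb.runMap par F x₀ y₀ (tstar ω) fun i => ξ i ω).2.1)
      (pb.runMap par F x₀ y₀ (tstar ω) fun i => ξ i ω).2.2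
      (noiseMean pb.f F T B (pb.runMap par F x₀ y₀ (tstar ω) fun i => ξ i ω).1
        fun i => ξ i ω)) - pb.b := (pb.A.measurable.comp hxm).sub_const _
  refine ⟨memLp_two_of_lintegral_le hAm (sq_nonneg ε) (le_trans (lintegral_mono fun ω => ?_)
    (hmain.trans hmono)), _, fun ω => outCertificate_mem h hτ _ _ _ _,
    memLp_two_of_lintegral_le hvm (sq_nonneg ε) (le_trans (lintegral_mono fun ω => ?_)
      (hmain.trans hmono))⟩
  · exact ENNReal.ofReal_le_ofReal (hK par.η hst.η_pos.le hηω _ _).1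
  · exact ENNReal.ofReal_le_ofReal (hK par.η hst.η_pos.le hηω _ _).2

end LinConProblem
end

theorem mainTheorem2 {n m p : ℕ} (A : Vec n →L[ℝ] Vec m) (hA : A ≠ 0) (H : Vec n →L[ℝ] Vec p)
    (Lf ρ : ℝ) (hLf : 0 ≤ Lf) (hρ : 0 ≤ ρ) :
    -- the constant of the global error bound exists and depends only on `A`, `H`, `Lf`, `ρ`
    ∃ σ₀ : ℝ, 0 < σ₀ ∧
    ∀ pb : LinConProblem n m p, pb.A = A → pb.H = H → pb.Regular Lf →
      pb.IsErrorBoundConst ρ (muParam Lf) σ₀ ∧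
      ∀ σbar : ℝ, 0 < σbar → pb.IsErrorBoundConst ρ (muParam Lf) σbar →
      ∀ (σ : ℝ) (x₀ : Vec n) (y₀ : Vec m) (τhat : ℝ), x₀ ∈ pb.X →
      0 < τhat → τhat ≤ 1 / LKParam Lf ρ ‖A‖ →
      -- the constants hidden in the `Ω` and `O` notation
      ∃ cT cB C : ℝ, 0 < cT ∧ 0 < cB ∧ 0 < C ∧
      ∀ ε : ℝ, 0 < ε → ε ≤ 1 → ∀ T B : ℕ, cT / ε ^ 4 ≤ (T : ℝ) → cB / ε ^ 2 ≤ (B : ℝ) →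
      ∀ {S Ω : Type*} [MeasurableSpace S] [MeasurableSpace Ω]
        (Q : Measure S) [IsProbabilityMeasure Q] (P : Measure Ω) [IsProbabilityMeasure P]
        (F : Vec n → S → Vec n) (ξ : ℕ → Ω → S) (tstar : Ω → ℕ),
        IsStochasticOracle pb.f σ Q F → IsSampling P Q ξ T tstar →
        let out : Ω → AlgOutput n m := fun ω =>
          pb.procedure (algParams Lf ρ ‖A‖ σbar T) τhat F (fun k => ξ k ω) x₀ y₀ T B (tstar ω)
        pb.IsEpsStationary P (fun ω => (out ω).x) (fun ω => (out ω).y) ε ∧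
        (T = ⌈cT / ε ^ 4⌉₊ → B = ⌈cB / ε ^ 2⌉₊ → ∀ ω, ((out ω).calls : ℝ) ≤ C / ε ^ 4) := by
  have hμ0 : 0 < muParam Lf := by linarith [two_le_muParam Lf]
  obtain ⟨σ₀, hσ₀, hbound⟩ := LinConProblem.exists_isErrorBoundConst A H hLf
    (four_mul_le_muParam Lf) hμ0 hρ
  refine ⟨σ₀, hσ₀, fun pb hpA hpH h => ⟨hbound pb hpA hpH h, ?_⟩⟩
  subst hpA
  intro σbar hσbar hσ σ x₀ y₀ τhat _ hτ hτle
  obtain ⟨D, E, hD, hE, hrate⟩ :=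
    LinConProblem.exists_output_rate h hA hLf hρ hσbar hσ σ x₀ y₀ hτ hτle
  refine ⟨(2 * D) ^ 2 + 1, 2 * E + 1, (2 * D) ^ 2 + 1 + (2 * E + 1) + 2, by positivity,
    by positivity, by positivity, ?_⟩
  intro ε hε hε1 T B hT hB S Ω _ _ Q _ P _ F ξ tstar hF hs
  have hε2 : 0 < ε ^ 2 := by positivity
  have hε4 : 0 < ε ^ 4 := by positivity
  have hT0 : (0 : ℝ) < T := lt_of_lt_of_le (by positivity) hT
  have hB0 : (0 : ℝ) < B := lt_of_lt_of_le (by positivity) hB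
  have hTN : 0 < T := by exact_mod_cast hT0
  have hBN : 0 < B := by exact_mod_cast hB0
  have hDT : D / √T ≤ ε ^ 2 / 2 := by
    have h1 : 2 * D / ε ^ 2 ≤ √T := by
      refine Real.le_sqrt_of_sq_le (le_trans ?_ hT)
      rw [div_pow, ← pow_mul]
      exact div_le_div_of_nonneg_right (by linarith) hε4.le
    rw [div_le_iff₀ (Real.sqrt_pos.2 hT0)]
    rw [div_le_iff₀ hε2] at h1
    linarith
  have hEB : E / B ≤ ε ^ 2 / 2 := by
    rw [div_le_iff₀ hε2] at hB
    rw [div_le_iff₀ hB0]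
    linarith
  refine ⟨hrate T B hTN hBN Q P F ξ tstar hF hs ε (by linarith), ?_⟩
  intro hTc hBc ω
  have hcalls : (pb.procedure (algParams Lf ρ ‖pb.A‖ σbar T) τhat F (fun k => ξ k ω) x₀ y₀ T B
      (tstar ω)).calls = T + B := by
    rw [LinConProblem.procedure_eq _ _ _ _ _ _ _ hBN]
  have hTle : (T : ℝ) ≤ ((2 * D) ^ 2 + 1) / ε ^ 4 + 1 := by
    rw [hTc]
    exact (Nat.ceil_lt_add_one (by positivity)).le
  have hBle : (B : ℝ) ≤ (2 * E + 1) / ε ^ 2 + 1 := by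
    rw [hBc]
    exact (Nat.ceil_lt_add_one (by positivity)).le
  have hε24 : ε ^ 4 ≤ ε ^ 2 := pow_le_pow_of_le_one hε.le hε1 (by norm_num)
  have hB4 : (2 * E + 1) / ε ^ 2 ≤ (2 * E + 1) / ε ^ 4 :=
    div_le_div_of_nonneg_left (by positivity) hε4 hε24
  have h1 : 1 ≤ 1 / ε ^ 4 := by
    rw [le_div_iff₀ hε4, one_mul]
    exact pow_le_one₀ hε.le hε1
  change (((pb.procedure (algParams Lf ρ ‖pb.A‖ σbar T) τhat F (fun k => ξ k ω) x₀ y₀ T B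
      (tstar ω)).calls : ℕ) : ℝ) ≤ _
  rw [hcalls]
  push_cast
  have h2 : ((2 * D) ^ 2 + 1 + (2 * E + 1) + 2) / ε ^ 4 =
      ((2 * D) ^ 2 + 1) / ε ^ 4 + (2 * E + 1) / ε ^ 4 + 2 * (1 / ε ^ 4) := by
    ring
  rw [h2]
  linarith
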